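/- Let $d\ge 0$ be an integer and identify the dual of $\mathbb R^d$ with $\mathbb R^d$ by the Euclidean inner product. Let $H:\mathbb R\times\mathbb R^d\times\mathbb R^d\to\mathbb R$, $(t,q,p)\mapsto H(t,q,p)$, be of class $C^2$, and suppose that there are constants $m>0$ and $M$ such that, for all $(t,q,p)$, $\|d^2H(t,q,p)\|\le M$, $\partial^2_{pp}H(t,q,p)\ge m\,\mathrm{Id}$ in the sense of quadratic forms, and $\frac m2|p|^2-M\le H(t,q,p)\le \frac M2|p|^2+M$. Let $\varphi_\tau^t=(Q_\tau^t,P_\tau^t)$ be the flow from time $\tau$ to time $t$ of the Hamiltonian system $\dot q=\partial_pH(t,q,p)$, $\dot p=-\partial_qH(t,q,p)$. When $t-\tau>0$ is small enough, there is for all $q_0,q_1$ a unique orbit $(q(s),p(s))$ with $q(\tau)=q_0$ and $q(t)=q_1$; let $S_\tau^t(q_0,q_1)=\int_\tau^t \big(p(s)\cdot\dot q(s)-H(s,q(s),p(s))\big)\,ds$ be its action. For arbitrary $\tau<t$ let $$A_\tau^t(q_0,q_1)=\min_{\theta_1,\dots,\theta_{n-1}}\ \sum_{i=0}^{n-1}S_{\tau+i(t-\tau)/n}^{\tau+(i+1)(t-\tau)/n}(\theta_i,\theta_{i+1}),\qquad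 \theta_0=q_0,\ \theta_n=q_1,$$ where $n$ is any integer such that $(t-\tau)/n$ is small enough (the value does not depend on $n$). For $u:\mathbb R^d\to\mathbb R$ let $$\mathbf T_\tau^tu(q)=\inf_{\theta\in\mathbb R^d}\big(u(\theta)+A_\tau^t(\theta,q)\big),\qquad \Gamma_u=\{(q,du(q)):\ q\in\mathbb R^d,\ u\text{ is differentiable at }q\}.$$ Let $u:\mathbb R^d\to\mathbb R$ be Lipschitz and semi-concave, that is, $\theta\mapsto u(\theta)-K|\theta|^2$ is concave for some $K\in\mathbb R$. Then, for every $t>0$, $$\varphi_t^0\big(\overline{\Gamma_{\mathbf T_0^tu}}\big)\subset\Gamma_u,$$ and the set $\varphi_t^0\big(\overline{\Gamma_{\mathbf T_0^tu}}\big)$ is a Lipschitz graph, that is, the graph of a Lipschitz map from a subset of $\mathbb R^d$ to $\mathbb R^d$. -/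

import Mathlib

open Set Filter Topology

noncomputable section

namespace LaxOleinik

/-- The configuration space, with its Euclidean norm. Its dual is identified with it through the
inner product, so that a differential is a gradient. -/
abbrev Conf (d : ℕ) : Type := EuclideanSpace ℝ (Fin d)

/-- The phase space of points `(q, p)`. -/
abbrev Phase (d : ℕ) : Type := Conf d × Conf d

variable {d : ℕ}

/-- The standing assumptions on the time-dependent Hamiltonian `H (t, q, p)`: it is of class `C²`,
its second differential is bounded, it is uniformly convex in `p`, and it has quadratic growth
in `p`. -/
structure IsAdmissible (H : ℝ × Conf d × Conf d → ℝ) (m M : ℝ) : Prop where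
  contDiff : ContDiff ℝ 2 H
  norm_hessian_le : ∀ z, ‖fderiv ℝ (fderiv ℝ H) z‖ ≤ M
  m_pos : 0 < m
  hessian_pp_ge : ∀ (t : ℝ) (q p v : Conf d),
    m * ‖v‖ ^ 2 ≤ fderiv ℝ (fderiv ℝ (fun p' : Conf d => H (t, q, p'))) p v v
  le_growth : ∀ (t : ℝ) (q p : Conf d), m / 2 * ‖p‖ ^ 2 - M ≤ H (t, q, p)
  growth_le : ∀ (t : ℝ) (q p : Conf d), H (t, q, p) ≤ M / 2 * ‖p‖ ^ 2 + M

/-- The Hamiltonian vector field `(∂_p H, - ∂_q H)` at time `t`. -/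
def vectorField (H : ℝ × Conf d × Conf d → ℝ) (t : ℝ) (x : Phase d) : Phase d :=
  (gradient (fun p : Conf d => H (t, x.1, p)) x.2,
    -gradient (fun q : Conf d => H (t, q, x.2)) x.1)

/-- The solutions of the Hamiltonian system, defined for all times. -/
def IsOrbit (H : ℝ × Conf d × Conf d → ℝ) (x : ℝ → Phase d) : Prop :=
  ∀ s : ℝ, HasDerivAt x (vectorField H s (x s)) s

/-- The flow map from time `τ` to time `t`: the value at time `t` of the orbit which is at `x`
at time `τ`. Under the standing assumptions that orbit exists and is unique. -/
def flow (H : ℝ × Conf d × Conf d → ℝ) (τ t : ℝ) (x : Phase d) : Phase d :=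
  Classical.epsilon (fun γ : ℝ → Phase d => IsOrbit H γ ∧ γ τ = x) t

/-- The Hamiltonian action `∫ p · q̇ - H(s, q, p) ds` of the curve `x = (q, p)` on `[τ, t]`. -/
def action (H : ℝ × Conf d × Conf d → ℝ) (τ t : ℝ) (x : ℝ → Phase d) : ℝ :=
  ∫ s in τ..t, (inner ℝ (x s).2 (deriv (fun r => (x r).1) s) - H (s, (x s).1, (x s).2))

/-- The initial momentum of the orbit which joins `q₀` at time `τ` to `q₁` at time `t`; it is
unique when `t - τ` is positive and small. -/
def initialMomentum (H : ℝ × Conf d × Conf d → ℝ) (τ t : ℝ) (q₀ q₁ : Conf d) : Conf d :=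
  Classical.epsilon (fun p : Conf d => (flow H τ t (q₀, p)).1 = q₁)

/-- The generating function `S_τ^t(q₀, q₁)`: the action on `[τ, t]` of the unique orbit which
joins `q₀` at time `τ` to `q₁` at time `t`, when `t - τ` is positive and small. -/
def genFun (H : ℝ × Conf d × Conf d → ℝ) (τ t : ℝ) (q₀ q₁ : Conf d) : ℝ :=
  action H τ t (fun s => flow H τ s (q₀, initialMomentum H τ t q₀ q₁))

/-- The `i`-th point of the regular subdivision of `[τ, t]` into `n` intervals. -/
def node (τ t : ℝ) (n i : ℕ) : ℝ := τ + i * ((t - τ) / n)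

/-- The action of the broken orbit through the points `θ 0, …, θ n` at the times of the regular
subdivision of `[τ, t]` into `n` intervals. -/
def brokenAction (H : ℝ × Conf d × Conf d → ℝ) (τ t : ℝ) (n : ℕ) (θ : ℕ → Conf d) : ℝ :=
  ∑ i ∈ Finset.range n, genFun H (node τ t n i) (node τ t n (i + 1)) (θ i) (θ (i + 1))

/-- The minimum of the action among the broken orbits with `n` pieces from `q₀` to `q₁`. -/
def brokenMin (H : ℝ × Conf d × Conf d → ℝ) (n : ℕ) (τ t : ℝ) (q₀ q₁ : Conf d) : ℝ :=
  ⨅ θ : {θ : ℕ → Conf d // θ 0 = q₀ ∧ θ n = q₁}, brokenAction H τ t n θ.1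

/-- The minimal action `A_τ^t(q₀, q₁)`: the value of `brokenMin` for any integer `n` such that
`(t - τ) / n < σ`, with `σ > 0` small; this value does not depend on `n`. -/
def minAction (H : ℝ × Conf d × Conf d → ℝ) (τ t : ℝ) (q₀ q₁ : Conf d) : ℝ :=
  Classical.epsilon (fun a : ℝ => ∃ σ : ℝ, 0 < σ ∧
    ∀ n : ℕ, 0 < n → (t - τ) / n < σ → brokenMin H n τ t q₀ q₁ = a)

/-- The Lax-Oleinik operator `T_τ^t`. The infimum is finite when `u` is Lipschitz. -/
def laxOleinik (H : ℝ × Conf d × Conf d → ℝ) (τ t : ℝ) (u : Conf d → ℝ) : Conf d → ℝ :=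
  fun q => ⨅ θ : Conf d, (u θ + minAction H τ t θ q)

/-- `u` is semi-concave: `θ ↦ u θ - K |θ|²` is concave for some `K`. -/
def IsSemiconcave (u : Conf d → ℝ) : Prop :=
  ∃ K : ℝ, ConcaveOn ℝ univ (fun θ : Conf d => u θ - K * ‖θ‖ ^ 2)

/-- The graph of the differential of `u`, over the points where `u` is differentiable. -/
def diffGraph (u : Conf d → ℝ) : Set (Phase d) := {x | HasGradientAt u x.2 x.1}

/-- `G` is the graph of a Lipschitz map defined on a subset of the configuration space. -/
def IsLipschitzGraph (G : Set (Phase d)) : Prop :=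
  ∃ (D : Set (Conf d)) (f : Conf d → Conf d) (C : NNReal),
    LipschitzOnWith C f D ∧ G = (fun q => (q, f q)) '' D

end LaxOleinik

end

/-! Write `T u` for the Lax-Oleinik image of `u` at time `t`. Since `u` is Lipschitz and the action
is coercive, the infimum defining `T u q` is attained, and it is attained along a genuine orbit
ending over `q`. Call such an orbit calibrated. Two one-sided estimates at its ends give the
theorem.

At the final end, moving the last point of the minimizing chain places `T u` below a paraboloid
whose slope is the final momentum. So wherever `T u` is differentiable, its gradient is that
momentum: the graph of the differential lies in `calibratedSet` (`diffGraph_subset_calibratedSet`).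
This set is closed (`isClosed_calibratedSet`), so it contains the closure of the graph.

At the initial end, moving the first point places `u` above a paraboloid whose slope is the initial
momentum, with a curvature independent of the orbit (`exists_quadratic_lower_bound`). Semi-concavity
of `u` turns this into a paraboloid above `u` with the same slope
(`quadratic_upper_bound_of_lower_bound`). A function squeezed in this way is differentiable, and its
gradients at such points are Lipschitz in the point (`norm_sub_le_of_quadratic_bounds`).

The variational part is finite-dimensional. For short times an orbit is determined by its end
positions, because the final position is strongly monotone in the initial momentum. The generating
function is semi-concave with the momenta as slopes (`exists_action_semiconcave`), so a minimizing
broken orbit has no corner (`exists_orbit_of_min_chain`). -/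

namespace LaxOleinik

/-! ### Regularity of the Hamiltonian vector field and convexity estimates for `H`. -/

section VectorField

variable {d : ℕ} {H : ℝ × Conf d × Conf d → ℝ} {m M : ℝ}

theorem IsAdmissible.M_nonneg (hH : IsAdmissible H m M) : 0 ≤ M :=
  (norm_nonneg (fderiv ℝ (fderiv ℝ H) 0)).trans (hH.norm_hessian_le 0)

theorem IsAdmissible.hasFDerivAt (hH : IsAdmissible H m M) (z : ℝ × Conf d × Conf d) :
    HasFDerivAt H (fderiv ℝ H z) z :=
  ((hH.contDiff.differentiable (by norm_num)) z).hasFDerivAt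

/-- The inclusion of the fibre variable `p`. -/
abbrev inclP (d : ℕ) : Conf d →L[ℝ] ℝ × Conf d × Conf d :=
  (ContinuousLinearMap.inr ℝ ℝ (Conf d × Conf d)).comp (ContinuousLinearMap.inr ℝ (Conf d) (Conf d))

/-- The inclusion of the base variable `q`. -/
abbrev inclQ (d : ℕ) : Conf d →L[ℝ] ℝ × Conf d × Conf d :=
  (ContinuousLinearMap.inr ℝ ℝ (Conf d × Conf d)).comp (ContinuousLinearMap.inl ℝ (Conf d) (Conf d))

theorem IsAdmissible.hasFDerivAt_p (hH : IsAdmissible H m M) (t : ℝ) (q p : Conf d) :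
    HasFDerivAt (fun p' : Conf d => H (t, q, p')) ((fderiv ℝ H (t, q, p)).comp (inclP d)) p :=
  (hH.hasFDerivAt (t, q, p)).comp p
    ((hasFDerivAt_prodMk_right t (q, p)).comp p (hasFDerivAt_prodMk_right q p))

theorem IsAdmissible.hasFDerivAt_q (hH : IsAdmissible H m M) (t : ℝ) (q p : Conf d) :
    HasFDerivAt (fun q' : Conf d => H (t, q', p)) ((fderiv ℝ H (t, q, p)).comp (inclQ d)) q :=
  (hH.hasFDerivAt (t, q, p)).comp q
    ((hasFDerivAt_prodMk_right t (q, p)).comp q (hasFDerivAt_prodMk_left q p))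

theorem IsAdmissible.vectorField_fst (hH : IsAdmissible H m M) (t : ℝ) (x : Phase d) :
    (vectorField H t x).1 =
      (InnerProductSpace.toDual ℝ (Conf d)).symm ((fderiv ℝ H (t, x)).comp (inclP d)) := by
  simp only [vectorField, gradient]
  rw [(hH.hasFDerivAt_p t x.1 x.2).fderiv]

theorem IsAdmissible.vectorField_snd (hH : IsAdmissible H m M) (t : ℝ) (x : Phase d) :
    (vectorField H t x).2 =
      -(InnerProductSpace.toDual ℝ (Conf d)).symm ((fderiv ℝ H (t, x)).comp (inclQ d)) := by
  simp only [vectorField, gradient]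
  rw [(hH.hasFDerivAt_q t x.1 x.2).fderiv]

theorem IsAdmissible.lipschitzWith_fderiv (hH : IsAdmissible H m M) :
    LipschitzWith M.toNNReal (fderiv ℝ H) := by
  refine lipschitzWith_of_nnnorm_fderiv_le (𝕜 := ℝ)
    ((hH.contDiff.fderiv_right (m := 1) (by norm_num)).differentiable (by norm_num)) fun z => ?_
  rw [← NNReal.coe_le_coe, coe_nnnorm, Real.coe_toNNReal _ hH.M_nonneg]
  exact hH.norm_hessian_le z

theorem norm_inclP_le : ‖inclP d‖ ≤ 1 :=
  ContinuousLinearMap.opNorm_le_bound _ zero_le_one fun v => by simp [Prod.norm_def]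

theorem norm_inclQ_le : ‖inclQ d‖ ≤ 1 :=
  ContinuousLinearMap.opNorm_le_bound _ zero_le_one fun v => by simp [Prod.norm_def]

/-- Both components are the differential of `H` composed with an inclusion of norm at most one. The
sup norm on products therefore preserves the constant `M`. -/
theorem IsAdmissible.norm_vectorField_sub_le (hH : IsAdmissible H m M) (t t' : ℝ) (x x' : Phase d) :
    ‖vectorField H t x - vectorField H t' x'‖ ≤ M * ‖(t, x) - (t', x')‖ := by
  have h0 : ‖fderiv ℝ H (t, x) - fderiv ℝ H (t', x')‖ ≤ M * ‖(t, x) - (t', x')‖ := by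
    have := hH.lipschitzWith_fderiv.norm_sub_le (t, x) (t', x')
    rwa [Real.coe_toNNReal _ hH.M_nonneg] at this
  have key : ∀ i : Conf d →L[ℝ] ℝ × Conf d × Conf d, ‖i‖ ≤ 1 →
      ‖(InnerProductSpace.toDual ℝ (Conf d)).symm ((fderiv ℝ H (t, x)).comp i) -
        (InnerProductSpace.toDual ℝ (Conf d)).symm ((fderiv ℝ H (t', x')).comp i)‖ ≤
        M * ‖(t, x) - (t', x')‖ := by
    intro i hi
    rw [← map_sub, LinearIsometryEquiv.norm_map, ← ContinuousLinearMap.sub_comp]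
    refine (ContinuousLinearMap.opNorm_comp_le _ _).trans (le_trans ?_ h0)
    exact mul_le_of_le_one_right (norm_nonneg _) hi
  rw [Prod.norm_def]
  refine max_le ?_ ?_
  · rw [Prod.fst_sub, hH.vectorField_fst, hH.vectorField_fst]
    exact key _ norm_inclP_le
  · rw [Prod.snd_sub, hH.vectorField_snd, hH.vectorField_snd, neg_sub_neg, norm_sub_rev]
    exact key _ norm_inclQ_le

theorem IsAdmissible.norm_vectorField_sub_le' (hH : IsAdmissible H m M) (t : ℝ) (x x' : Phase d) :
    ‖vectorField H t x - vectorField H t x'‖ ≤ M * ‖x - x'‖ := by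
  have := hH.norm_vectorField_sub_le t t x x'
  have h0 : ‖(t, x) - (t, x')‖ = ‖x - x'‖ := by
    rw [Prod.norm_def, Prod.fst_sub, Prod.snd_sub, sub_self, norm_zero,
      max_eq_right (norm_nonneg _)]
  rwa [h0] at this

theorem IsAdmissible.lipschitzWith_vectorField (hH : IsAdmissible H m M) (t : ℝ) :
    LipschitzWith M.toNNReal (vectorField H t) :=
  LipschitzWith.of_dist_le_mul fun x y => by
    rw [dist_eq_norm, dist_eq_norm, Real.coe_toNNReal _ hH.M_nonneg]
    exact hH.norm_vectorField_sub_le' t x y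

theorem IsAdmissible.contDiff_vectorField (hH : IsAdmissible H m M) :
    ContDiff ℝ 1 (fun z : ℝ × Phase d => vectorField H z.1 z.2) := by
  have h := hH.contDiff.fderiv_right (m := 1) (by norm_num)
  have key : ∀ i : Conf d →L[ℝ] ℝ × Conf d × Conf d, ContDiff ℝ 1 (fun z : ℝ × Phase d =>
      (InnerProductSpace.toDual ℝ (Conf d)).symm ((fderiv ℝ H z).comp i)) := fun i =>
    ((InnerProductSpace.toDual ℝ (Conf d)).symm.contDiff).comp (h.clm_comp contDiff_const)
  refine ContDiff.prodMk (f := fun z : ℝ × Phase d => (vectorField H z.1 z.2).1)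
    (g := fun z : ℝ × Phase d => (vectorField H z.1 z.2).2) ?_ ?_
  · simp only [hH.vectorField_fst]
    exact key _
  · simp only [hH.vectorField_snd]
    exact (key _).neg

theorem IsAdmissible.continuous_vectorField (hH : IsAdmissible H m M) :
    Continuous (fun z : ℝ × Phase d => vectorField H z.1 z.2) :=
  hH.contDiff_vectorField.continuous

theorem IsAdmissible.inner_vectorField_fst (hH : IsAdmissible H m M) (t : ℝ) (q p v : Conf d) :
    inner ℝ (vectorField H t (q, p)).1 v = fderiv ℝ (fun p' : Conf d => H (t, q, p')) p v := by
  rw [hH.vectorField_fst, InnerProductSpace.toDual_symm_apply, (hH.hasFDerivAt_p t q p).fderiv]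

theorem IsAdmissible.inner_vectorField_snd (hH : IsAdmissible H m M) (t : ℝ) (q p v : Conf d) :
    inner ℝ (vectorField H t (q, p)).2 v = -fderiv ℝ (fun q' : Conf d => H (t, q', p)) q v := by
  rw [hH.vectorField_snd, inner_neg_left, InnerProductSpace.toDual_symm_apply,
    (hH.hasFDerivAt_q t q p).fderiv]

/-- The remainder in the first order Taylor expansion of `H` in the base variable. -/
theorem IsAdmissible.abs_taylor_q_le (hH : IsAdmissible H m M) (t : ℝ) (q q' p : Conf d) :
    |H (t, q', p) - H (t, q, p) + inner ℝ (vectorField H t (q, p)).2 (q' - q)| ≤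
      M * ‖q' - q‖ ^ 2 := by
  rw [hH.inner_vectorField_snd, ← sub_eq_add_neg, ← Real.norm_eq_abs, pow_two, ← mul_assoc]
  -- The mean value inequality on the segment gives the constant `M` where an integral remainder
  -- would give `M / 2`; this suffices.
  refine (convex_segment (𝕜 := ℝ) q q').norm_image_sub_le_of_norm_fderiv_le' (𝕜 := ℝ)
    (f := fun q' : Conf d => H (t, q', p))
    (fun y _ => (hH.hasFDerivAt_q t y p).differentiableAt) (fun y hy => ?_)
    (left_mem_segment ℝ q q') (right_mem_segment ℝ q q')
  rw [(hH.hasFDerivAt_q t y p).fderiv, (hH.hasFDerivAt_q t q p).fderiv,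
    ← LinearIsometryEquiv.norm_map (InnerProductSpace.toDual ℝ (Conf d)).symm, map_sub]
  have h1 := hH.vectorField_snd t (y, p)
  have h2 := hH.vectorField_snd t (q, p)
  have h3 : ‖(vectorField H t (q, p)).2 - (vectorField H t (y, p)).2‖ ≤ M * ‖y - q‖ := by
    refine (norm_snd_le (vectorField H t (q, p) - vectorField H t (y, p))).trans
      ((hH.norm_vectorField_sub_le' t _ _).trans (le_of_eq ?_))
    simp [Prod.norm_def, norm_sub_rev]
  rw [h1, h2, neg_sub_neg] at h3
  refine h3.trans (mul_le_mul_of_nonneg_left ?_ hH.M_nonneg)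
  obtain ⟨a, ha, rfl⟩ := (segment_eq_image' ℝ q q').subset hy
  simp only [add_sub_cancel_left, norm_smul, Real.norm_eq_abs, abs_of_nonneg ha.1]
  exact mul_le_of_le_one_left (norm_nonneg _) ha.2

/-- Strong convexity of `H` in the momentum. -/
theorem IsAdmissible.strong_convex_p (hH : IsAdmissible H m M) (t : ℝ) (q p p' : Conf d) :
    H (t, q, p) + inner ℝ (vectorField H t (q, p)).1 (p' - p) + m / 2 * ‖p' - p‖ ^ 2 ≤
      H (t, q, p') := by
  set v := p' - p with hv
  set f : Conf d → ℝ := fun p' => H (t, q, p') with hf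
  have hfc : ContDiff ℝ 2 f := hH.contDiff.comp (by fun_prop)
  have hf1 : Differentiable ℝ f := hfc.differentiable (by norm_num)
  have hf2 : Differentiable ℝ (fderiv ℝ f) :=
    (hfc.fderiv_right (m := 1) (by norm_num)).differentiable (by norm_num)
  have hline : ∀ s : ℝ, HasDerivAt (fun s : ℝ => p + s • v) v s := fun s => by
    simpa using ((hasDerivAt_id s).smul_const v).const_add p
  have hg : ∀ s : ℝ, HasDerivAt (fun s : ℝ => f (p + s • v)) (fderiv ℝ f (p + s • v) v) s :=
    fun s => (hf1 _).hasFDerivAt.comp_hasDerivAt s (hline s)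
  have hg' : ∀ s : ℝ, HasDerivAt (fun s : ℝ => fderiv ℝ f (p + s • v) v)
      (fderiv ℝ (fderiv ℝ f) (p + s • v) v v) s := fun s => by
    have h1 : HasDerivAt (fun s : ℝ => fderiv ℝ f (p + s • v))
        (fderiv ℝ (fderiv ℝ f) (p + s • v) v) s :=
      (hf2 _).hasFDerivAt.comp_hasDerivAt s (hline s)
    simpa using h1.clm_apply (hasDerivAt_const s v)
  have hk' : ∀ s : ℝ, HasDerivAt (fun s : ℝ => fderiv ℝ f (p + s • v) v - s * (m * ‖v‖ ^ 2))
      (fderiv ℝ (fderiv ℝ f) (p + s • v) v v - m * ‖v‖ ^ 2) s := fun s => by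
    simpa using (hg' s).fun_sub ((hasDerivAt_id s).mul_const (m * ‖v‖ ^ 2))
  have hmono' : Monotone (fun s : ℝ => fderiv ℝ f (p + s • v) v - s * (m * ‖v‖ ^ 2)) :=
    monotone_of_deriv_nonneg (fun s => (hk' s).differentiableAt) fun s => by
      rw [(hk' s).deriv]
      exact sub_nonneg.2 (hH.hessian_pp_ge t q _ v)
  -- The derivative of this function is `hmono'` compared with its value at `0`, hence nonnegative
  -- on `[0, 1]`; comparing the values at `0` and `1` gives the claim.
  have hk : ∀ s : ℝ, HasDerivAt
      (fun s : ℝ => f (p + s • v) - s * fderiv ℝ f p v - s ^ 2 * (m / 2 * ‖v‖ ^ 2))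
      (fderiv ℝ f (p + s • v) v - fderiv ℝ f p v - s * (m * ‖v‖ ^ 2)) s := fun s => by
    have := ((hg s).sub ((hasDerivAt_id s).mul_const (fderiv ℝ f p v))).sub
      ((hasDerivAt_pow 2 s).mul_const (m / 2 * ‖v‖ ^ 2))
    refine this.congr_deriv ?_
    simp only [one_mul]
    ring
  have hmono : MonotoneOn
      (fun s : ℝ => f (p + s • v) - s * fderiv ℝ f p v - s ^ 2 * (m / 2 * ‖v‖ ^ 2)) (Icc 0 1) := by
    refine monotoneOn_of_deriv_nonneg (convex_Icc 0 1)
      (fun s _ => (hk s).continuousAt.continuousWithinAt)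
      (fun s _ => (hk s).differentiableAt.differentiableWithinAt) fun s hs => ?_
    rw [(hk s).deriv]
    rw [interior_Icc] at hs
    have := hmono' hs.1.le
    simp only [zero_smul, add_zero, zero_mul, sub_zero] at this
    linarith
  have h01 := hmono (left_mem_Icc.2 zero_le_one) (right_mem_Icc.2 zero_le_one) zero_le_one
  have hpv : p + v = p' := by rw [hv]; abel
  simp only [zero_smul, add_zero, zero_mul, sub_zero, one_smul, one_mul, one_pow, hpv,
    ne_eq, OfNat.ofNat_ne_zero, not_false_eq_true, zero_pow] at h01
  rw [hH.inner_vectorField_fst]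
  simp only [hf] at h01 ⊢
  linarith

/-- Strong monotonicity of `∂_p H` in the momentum. -/
theorem IsAdmissible.strong_monotone_p (hH : IsAdmissible H m M) (t : ℝ) (q p p' : Conf d) :
    m * ‖p' - p‖ ^ 2 ≤
      inner ℝ ((vectorField H t (q, p')).1 - (vectorField H t (q, p)).1) (p' - p) := by
  have h1 := hH.strong_convex_p t q p p'
  have h2 := hH.strong_convex_p t q p' p
  rw [← neg_sub p' p, inner_neg_right, norm_neg] at h2
  rw [inner_sub_left]
  linarith

end VectorField

/-! ### Completeness of Lipschitz vector fields. -/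

section GlobalExistence

variable {E : Type*} [NormedAddCommGroup E] [NormedSpace ℝ E] [CompleteSpace E]

/-- The point is that the existence time does not depend on `x₀`, which allows local solutions to be
continued indefinitely. -/
theorem exists_local_solution_of_lipschitzWith {V : E → E} {K : NNReal} (hV : LipschitzWith K V)
    (x₀ : E) : ∃ γ : ℝ → E, γ 0 = x₀ ∧
      ∀ t ∈ Ioo (-(1 / (1 + (K : ℝ)))) (1 / (1 + (K : ℝ))), HasDerivAt γ (V (γ t)) t := by
  have hε : (0 : ℝ) < 1 / (1 + (K : ℝ)) := by positivity
  set ε := 1 / (1 + (K : ℝ)) with hεdef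
  -- On the ball of radius `‖V x₀‖` the speed is at most `(1 + K) * ‖V x₀‖`, so a solution stays in
  -- it for a time `1 / (1 + K)`.
  have hPL : IsPicardLindelof (fun _ => V) (tmin := -ε) (tmax := ε)
      ⟨0, by constructor <;> linarith⟩ x₀ ‖V x₀‖₊ 0 ((1 + K) * ‖V x₀‖₊) K := by
    refine IsPicardLindelof.of_time_independent (fun x hx => ?_) hV.lipschitzOnWith ?_
    · have h1 := hV.norm_sub_le x x₀
      have h2 := norm_le_norm_sub_add (V x) (V x₀)
      have h3 : ‖x - x₀‖ ≤ ‖V x₀‖ := by simpa [dist_eq_norm] using hx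
      have h4 := mul_le_mul_of_nonneg_left h3 K.coe_nonneg
      rw [NNReal.coe_mul, NNReal.coe_add, NNReal.coe_one, coe_nnnorm]
      linarith
    · simp only [sub_zero, sub_neg_eq_add, zero_add, max_self, NNReal.coe_mul, NNReal.coe_add,
        NNReal.coe_one, coe_nnnorm, NNReal.coe_zero]
      have : (1 + (K : ℝ)) * ε = 1 := by rw [hεdef]; field_simp
      nlinarith [norm_nonneg (V x₀)]
  obtain ⟨α, h0, hα⟩ := hPL.exists_eq_forall_mem_Icc_hasDerivWithinAt₀
  exact ⟨α, h0, fun t ht => (hα t (Ioo_subset_Icc_self ht)).hasDerivAt (Icc_mem_nhds ht.1 ht.2)⟩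

/-- A globally Lipschitz `C¹` vector field is complete. -/
theorem exists_global_solution_of_lipschitzWith {V : E → E} {K : NNReal} (hV : LipschitzWith K V)
    (hV1 : ContDiff ℝ 1 V) (x₀ : E) :
    ∃ γ : ℝ → E, γ 0 = x₀ ∧ ∀ t, HasDerivAt γ (V (γ t)) t := by
  have hε : (0 : ℝ) < 1 / (1 + (K : ℝ)) := by positivity
  obtain ⟨γ, h0, hγ⟩ := exists_isMIntegralCurve_of_isMIntegralCurveOn (I := modelWithCornersSelf ℝ E)
    (v := V) (contMDiff_vectorSpace_iff_contDiff.2 hV1) hε (fun x => by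
      obtain ⟨γ, h0, hγ⟩ := exists_local_solution_of_lipschitzWith hV x
      exact ⟨γ, h0, fun t ht => (hγ t ht).hasFDerivAt.hasMFDerivAt.hasMFDerivWithinAt⟩) x₀
  refine ⟨γ, h0, ?_⟩
  intro t
  have h : HasFDerivAt γ ((1 : ℝ →L[ℝ] ℝ).smulRight (V (γ t))) t := (hγ t).hasFDerivAt
  simpa using h.hasDerivAt

end GlobalExistence

/-! ### The flow, its Grönwall estimates and the continuity of the action. -/

section Flow

variable {d : ℕ} {H : ℝ × Conf d × Conf d → ℝ} {m M : ℝ}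

/-- Time is added as a state variable of speed one. The suspended field is autonomous and still
`M`-Lipschitz up to truncation at zero, because the Hessian bound includes the time direction. -/
theorem IsAdmissible.exists_orbit (hH : IsAdmissible H m M) (τ : ℝ) (z : Phase d) :
    ∃ x : ℝ → Phase d, IsOrbit H x ∧ x τ = z := by
  set V : ℝ × Phase d → ℝ × Phase d := fun y => (1, vectorField H y.1 y.2) with hVdef
  have hV : LipschitzWith M.toNNReal V := LipschitzWith.of_dist_le_mul fun x y => by
    rw [dist_eq_norm, dist_eq_norm, Real.coe_toNNReal _ hH.M_nonneg, Prod.norm_def]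
    refine max_le ?_ (hH.norm_vectorField_sub_le x.1 y.1 x.2 y.2)
    simpa [hVdef] using mul_nonneg hH.M_nonneg (norm_nonneg (x - y))
  obtain ⟨γ, h0, hγ⟩ := exists_global_solution_of_lipschitzWith hV
    (contDiff_const.prodMk hH.contDiff_vectorField) (τ, z)
  have h1 : ∀ s, HasDerivAt (fun s => (γ s).1) 1 s := fun s => (hγ s).fst
  have h2 : ∀ s, HasDerivAt (fun s => (γ s).2) (vectorField H (γ s).1 (γ s).2) s :=
    fun s => (hγ s).snd
  have h3 : ∀ s, (γ s).1 = τ + s := fun s => by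
    have hc := is_const_of_deriv_eq_zero (f := fun s => (γ s).1 - s)
      (fun s => ((h1 s).fun_sub (hasDerivAt_id' s)).differentiableAt)
      (fun s => by rw [((h1 s).fun_sub (hasDerivAt_id' s)).deriv, sub_self]) s 0
    rw [h0] at hc
    simp only [sub_zero] at hc
    linarith
  refine ⟨fun s => (γ (s - τ)).2, fun s => ?_, by simp [h0]⟩
  have := (h2 (s - τ)).comp_sub_const s τ
  rwa [h3, add_sub_cancel] at this

theorem IsAdmissible.orbit_unique (hH : IsAdmissible H m M) {x y : ℝ → Phase d}
    (hx : IsOrbit H x) (hy : IsOrbit H y) {s : ℝ} (h : x s = y s) : x = y :=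
  ODE_solution_unique_univ (s := fun _ => univ)
    (fun t => (hH.lipschitzWith_vectorField t).lipschitzOnWith)
    (fun t => ⟨hx t, mem_univ _⟩) (fun t => ⟨hy t, mem_univ _⟩) h

theorem IsAdmissible.flow_spec (hH : IsAdmissible H m M) (τ : ℝ) (z : Phase d) :
    IsOrbit H (fun s => flow H τ s z) ∧ flow H τ τ z = z :=
  Classical.epsilon_spec (hH.exists_orbit τ z)

theorem IsAdmissible.isOrbit_flow (hH : IsAdmissible H m M) (τ : ℝ) (z : Phase d) :
    IsOrbit H (fun s => flow H τ s z) := (hH.flow_spec τ z).1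

theorem IsAdmissible.flow_self (hH : IsAdmissible H m M) (τ : ℝ) (z : Phase d) :
    flow H τ τ z = z := (hH.flow_spec τ z).2

theorem IsAdmissible.flow_orbit (hH : IsAdmissible H m M) {x : ℝ → Phase d} (hx : IsOrbit H x)
    (τ s : ℝ) : flow H τ s (x τ) = x s :=
  congrFun (hH.orbit_unique (hH.isOrbit_flow τ (x τ)) hx (hH.flow_self τ (x τ))) s

theorem IsOrbit.continuous {x : ℝ → Phase d} (hx : IsOrbit H x) : Continuous x :=
  continuous_iff_continuousAt.2 fun s => (hx s).continuousAt

theorem IsOrbit.hasDerivAt_fst {x : ℝ → Phase d} (hx : IsOrbit H x) (s : ℝ) :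
    HasDerivAt (fun r => (x r).1) (vectorField H s (x s)).1 s := (hx s).fst

theorem IsOrbit.hasDerivAt_snd {x : ℝ → Phase d} (hx : IsOrbit H x) (s : ℝ) :
    HasDerivAt (fun r => (x r).2) (vectorField H s (x s)).2 s := (hx s).snd

theorem IsAdmissible.norm_orbit_sub_le_of_le (hH : IsAdmissible H m M) {x y : ℝ → Phase d}
    (hx : IsOrbit H x) (hy : IsOrbit H y) {a s : ℝ} (h : a ≤ s) :
    ‖x s - y s‖ ≤ ‖x a - y a‖ * Real.exp (M * (s - a)) := by
  have := dist_le_of_trajectories_ODE (a := a) (b := s) hH.lipschitzWith_vectorField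
    hx.continuous.continuousOn (fun t _ => (hx t).hasDerivWithinAt)
    hy.continuous.continuousOn (fun t _ => (hy t).hasDerivWithinAt) le_rfl s
    (right_mem_Icc.2 h)
  rwa [dist_eq_norm, dist_eq_norm, Real.coe_toNNReal _ hH.M_nonneg] at this

/-- Time reversal keeps the Lipschitz constant, so the forward Grönwall estimate applies. -/
theorem IsAdmissible.norm_orbit_sub_le_of_ge (hH : IsAdmissible H m M) {x y : ℝ → Phase d}
    (hx : IsOrbit H x) (hy : IsOrbit H y) {a s : ℝ} (h : s ≤ a) :
    ‖x s - y s‖ ≤ ‖x a - y a‖ * Real.exp (M * (a - s)) := by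
  have hr : ∀ {z : ℝ → Phase d}, IsOrbit H z → ∀ t,
      HasDerivAt (fun t => z (-t)) (-vectorField H (-t) (z (-t))) t := fun hz t => by
    have := (hz (-t)).scomp t (hasDerivAt_neg t)
    rwa [neg_one_smul] at this
  have := dist_le_of_trajectories_ODE (a := -a) (b := -s) (K := M.toNNReal)
    (v := fun t z => -vectorField H (-t) z)
    (f := fun t => x (-t)) (g := fun t => y (-t))
    (fun t => (hH.lipschitzWith_vectorField (-t)).neg)
    (hx.continuous.comp continuous_neg).continuousOn (fun t _ => (hr hx t).hasDerivWithinAt)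
    (hy.continuous.comp continuous_neg).continuousOn (fun t _ => (hr hy t).hasDerivWithinAt) le_rfl
    (-s) (right_mem_Icc.2 (neg_le_neg h))
  simp only [neg_neg] at this
  rwa [dist_eq_norm, dist_eq_norm, Real.coe_toNNReal _ hH.M_nonneg, sub_neg_eq_add,
    neg_add_eq_sub] at this

theorem IsAdmissible.norm_orbit_sub_le (hH : IsAdmissible H m M) {x y : ℝ → Phase d}
    (hx : IsOrbit H x) (hy : IsOrbit H y) (a s : ℝ) :
    ‖x s - y s‖ ≤ ‖x a - y a‖ * Real.exp (M * |s - a|) := by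
  rcases le_total a s with h | h
  · rw [abs_of_nonneg (sub_nonneg.2 h)]
    exact hH.norm_orbit_sub_le_of_le hx hy h
  · rw [abs_of_nonpos (sub_nonpos.2 h), neg_sub]
    exact hH.norm_orbit_sub_le_of_ge hx hy h

theorem IsAdmissible.norm_flow_sub_le (hH : IsAdmissible H m M) (τ s : ℝ) (z z' : Phase d) :
    ‖flow H τ s z - flow H τ s z'‖ ≤ ‖z - z'‖ * Real.exp (M * |s - τ|) := by
  have := hH.norm_orbit_sub_le (hH.isOrbit_flow τ z) (hH.isOrbit_flow τ z') τ s
  rwa [hH.flow_self, hH.flow_self] at this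

theorem IsAdmissible.continuous_flow (hH : IsAdmissible H m M) (τ : ℝ) :
    Continuous (fun w : Phase d × ℝ => flow H τ w.2 w.1) := by
  refine continuous_iff_continuousAt.2 fun w₀ => ?_
  rw [ContinuousAt, tendsto_iff_norm_sub_tendsto_zero]
  have h1 : Tendsto (fun w : Phase d × ℝ => ‖w.1 - w₀.1‖ * Real.exp (M * |w.2 - τ|) +
      ‖flow H τ w.2 w₀.1 - flow H τ w₀.2 w₀.1‖) (𝓝 w₀)
      (𝓝 (‖w₀.1 - w₀.1‖ * Real.exp (M * |w₀.2 - τ|) +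
        ‖flow H τ w₀.2 w₀.1 - flow H τ w₀.2 w₀.1‖)) := by
    have hc : Continuous fun w : Phase d × ℝ => flow H τ w.2 w₀.1 :=
      (hH.isOrbit_flow τ w₀.1).continuous.comp continuous_snd
    exact Continuous.tendsto (by fun_prop) w₀
  simp only [sub_self, norm_zero, zero_mul, add_zero] at h1
  refine squeeze_zero (fun _ => norm_nonneg _) (fun w => ?_) h1
  calc ‖flow H τ w.2 w.1 - flow H τ w₀.2 w₀.1‖
      ≤ ‖flow H τ w.2 w.1 - flow H τ w.2 w₀.1‖ + ‖flow H τ w.2 w₀.1 - flow H τ w₀.2 w₀.1‖ :=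
        norm_sub_le_norm_sub_add_norm_sub _ _ _
    _ ≤ _ := by
      gcongr
      exact hH.norm_flow_sub_le τ w.2 w.1 w₀.1

/-- The integrand of the action, `⟨p, ∂_p H⟩ - H`. -/
noncomputable def lagrangian (H : ℝ × Conf d × Conf d → ℝ) (s : ℝ) (x : Phase d) : ℝ :=
  inner ℝ x.2 (vectorField H s x).1 - H (s, x)

theorem IsAdmissible.continuous_lagrangian (hH : IsAdmissible H m M) :
    Continuous (fun w : ℝ × Phase d => lagrangian H w.1 w.2) := by
  have h1 := hH.continuous_vectorField
  have h2 := hH.contDiff.continuous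
  exact (continuous_snd.snd.inner h1.fst).sub h2

theorem IsOrbit.continuous_lagrangian (hH : IsAdmissible H m M) {x : ℝ → Phase d}
    (hx : IsOrbit H x) : Continuous (fun s => lagrangian H s (x s)) := by
  have h : Continuous (fun s => ((s, x s) : ℝ × Phase d)) := continuous_id.prodMk hx.continuous
  have h2 := hH.continuous_lagrangian
  have h3 := h2.comp h
  exact h3

theorem IsOrbit.action_eq {x : ℝ → Phase d} (hx : IsOrbit H x) (a b : ℝ) :
    action H a b x = ∫ s in a..b, lagrangian H s (x s) := by
  unfold action lagrangian
  congr 1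
  funext s
  rw [(hx.hasDerivAt_fst s).deriv]

theorem IsAdmissible.continuous_action_flow (hH : IsAdmissible H m M) (τ a b : ℝ) :
    Continuous (fun z : Phase d => action H a b (fun s => flow H τ s z)) := by
  simp only [(hH.isOrbit_flow τ _).action_eq]
  have h : Continuous (fun w : Phase d × ℝ => ((w.2, flow H τ w.2 w.1) : ℝ × Phase d)) :=
    continuous_snd.prodMk (hH.continuous_flow τ)
  have h2 := hH.continuous_lagrangian
  have h3 := h2.comp h
  exact intervalIntegral.continuous_parametric_intervalIntegral_of_continuous'
    (f := fun z s => lagrangian H s (flow H τ s z)) h3 a b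

end Flow

/-! ### Surjectivity of strongly monotone maps. -/

section StronglyMonotone

variable {E : Type*} [NormedAddCommGroup E] [InnerProductSpace ℝ E] [CompleteSpace E]

/-- A Lipschitz and strongly monotone map of a Hilbert space is onto. -/
theorem surjective_of_strongly_monotone {F : E → E} {L c : ℝ} (hc : 0 < c)
    (hL : ∀ x y, ‖F x - F y‖ ≤ L * ‖x - y‖)
    (hF : ∀ x y, c * ‖x - y‖ ^ 2 ≤ inner ℝ (F x - F y) (x - y)) : Function.Surjective F := by
  intro z
  -- A zero of `F - z` is sought as a fixed point of `x ↦ x - l • (F x - z)`, whose squared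
  -- Lipschitz constant is at most `1 - 2lc + l²L²`. This choice of `l` bounds it by `1 - lc < 1`,
  -- and keeps `1 - lc` nonnegative.
  set l := c / (c ^ 2 + L ^ 2) with hl
  have hcL : 0 < c ^ 2 + L ^ 2 := by positivity
  have hl0 : 0 < l := by positivity
  have hlc : l * (c ^ 2 + L ^ 2) = c := div_mul_cancel₀ _ hcL.ne'
  have hk1 : 1 - l * c < 1 := by nlinarith
  have hk0 : 0 ≤ 1 - l * c := by
    have : l * c * (c ^ 2 + L ^ 2) = c ^ 2 := by rw [mul_right_comm, hlc, pow_two]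
    by_contra h
    nlinarith [sq_nonneg L]
  set k : NNReal := ⟨√(1 - l * c), Real.sqrt_nonneg _⟩ with hk
  have hcontr : ContractingWith k (fun x => x - l • (F x - z)) := by
    refine ⟨?_, LipschitzWith.of_dist_le_mul fun x y => ?_⟩
    · rw [← NNReal.coe_lt_coe]
      exact (Real.sqrt_lt_sqrt hk0 hk1).trans_eq Real.sqrt_one
    · rw [dist_eq_norm, dist_eq_norm]
      change _ ≤ √(1 - l * c) * _
      refine le_of_sq_le_sq ?_ (by positivity)
      rw [mul_pow, Real.sq_sqrt hk0]
      have h1 : x - l • (F x - z) - (y - l • (F y - z)) = (x - y) - l • (F x - F y) := by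
        simp only [smul_sub]; abel
      rw [h1, norm_sub_sq_real, inner_smul_right, norm_smul, real_inner_comm, Real.norm_eq_abs,
        abs_of_pos hl0, mul_pow]
      have h2 : ‖F x - F y‖ ^ 2 ≤ L ^ 2 * ‖x - y‖ ^ 2 := by
        rw [← mul_pow]
        exact pow_le_pow_left₀ (norm_nonneg _) (hL x y) 2
      have h3 := mul_le_mul_of_nonneg_left h2 (sq_nonneg l)
      have h4 := mul_le_mul_of_nonneg_left (hF x y) hl0.le
      have h5 : l ^ 2 * L ^ 2 ≤ l * c := by
        have : l ^ 2 * (c ^ 2 + L ^ 2) = l * c := by rw [pow_two, mul_assoc, hlc]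
        nlinarith [sq_nonneg (l * c)]
      have h6 := mul_le_mul_of_nonneg_right h5 (sq_nonneg ‖x - y‖)
      nlinarith
  obtain ⟨x, hx, -⟩ := hcontr.exists_fixedPoint z (edist_ne_top _ _)
  refine ⟨x, ?_⟩
  have hx' : x - l • (F x - z) = x := hx
  rw [sub_eq_self, smul_eq_zero, sub_eq_zero] at hx'
  exact hx'.resolve_left hl0.ne'

end StronglyMonotone

/-! ### Short orbits: determination by the end positions, and estimates of their action. -/

section ShortTime

variable {d : ℕ} {H : ℝ × Conf d × Conf d → ℝ} {m M : ℝ} {x y : ℝ → Phase d} {a b : ℝ}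

theorem IsAdmissible.norm_orbit_drift_le (hH : IsAdmissible H m M)
    (hx : IsOrbit H x) (hy : IsOrbit H y) {s : ℝ} (h : a ≤ s) :
    ‖(x s - y s) - (x a - y a)‖ ≤
      M * (‖x a - y a‖ * Real.exp (M * (s - a))) * (s - a) := by
  have := (convex_Icc a s).norm_image_sub_le_of_norm_hasDerivWithin_le
    (f := fun r => x r - y r) (f' := fun r => vectorField H r (x r) - vectorField H r (y r))
    (C := M * (‖x a - y a‖ * Real.exp (M * (s - a))))
    (fun r _ => ((hx r).fun_sub (hy r)).hasDerivWithinAt) (fun r hr => ?_)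
    (left_mem_Icc.2 h) (right_mem_Icc.2 h)
  · rwa [Real.norm_eq_abs, abs_of_nonneg (sub_nonneg.2 h)] at this
  · refine (hH.norm_vectorField_sub_le' r _ _).trans
      (mul_le_mul_of_nonneg_left ?_ hH.M_nonneg)
    refine (hH.norm_orbit_sub_le_of_le hx hy hr.1).trans ?_
    gcongr
    · exact hH.M_nonneg
    · exact hr.2

/-- A time below which orbits are determined by their end positions. -/
noncomputable def shortTime (m M : ℝ) : ℝ := min 1 (m / (2 * (M ^ 2 * Real.exp M + 1)))

theorem shortTime_pos (hm : 0 < m) : 0 < shortTime m M :=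
  lt_min one_pos (by positivity)

/-- This estimate dictates `shortTime`: the bound `1` replaces the exponential by `exp M`, and the
other bound makes `M² exp M (s - a)` at most `m / 2`, so that half of the convexity constant
survives. The `+ 1` there keeps the denominator positive. -/
theorem IsAdmissible.norm_orbit_drift_le_of_short (hH : IsAdmissible H m M)
    (hx : IsOrbit H x) (hy : IsOrbit H y) {s : ℝ} (h : a ≤ s) (hs : s - a ≤ shortTime m M) :
    M * ‖(x s - y s) - (x a - y a)‖ ≤ m / 2 * ‖x a - y a‖ := by
  have hM := hH.M_nonneg
  have h0 : 0 ≤ s - a := sub_nonneg.2 h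
  have h1 : s - a ≤ 1 := hs.trans (min_le_left _ _)
  have h2 : (s - a) * (2 * (M ^ 2 * Real.exp M + 1)) ≤ m :=
    (le_div_iff₀ (by positivity)).1 (hs.trans (min_le_right _ _))
  have h3 : Real.exp (M * (s - a)) ≤ Real.exp M :=
    Real.exp_le_exp.2 (mul_le_of_le_one_right hM h1)
  calc M * ‖(x s - y s) - (x a - y a)‖
      ≤ M * (M * (‖x a - y a‖ * Real.exp (M * (s - a))) * (s - a)) :=
        mul_le_mul_of_nonneg_left (hH.norm_orbit_drift_le hx hy h) hM
    _ ≤ M * (M * (‖x a - y a‖ * Real.exp M) * (s - a)) := by gcongr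
    _ = (s - a) * (M ^ 2 * Real.exp M) * ‖x a - y a‖ := by ring
    _ ≤ m / 2 * ‖x a - y a‖ := by
      gcongr
      linarith

/-- For short times, the final position is a strongly monotone function of the initial momentum. -/
theorem IsAdmissible.strong_monotone_endpoint (hH : IsAdmissible H m M)
    (hx : IsOrbit H x) (hy : IsOrbit H y) (hab : a ≤ b) (hs : b - a ≤ shortTime m M)
    (hq : (x a).1 = (y a).1) :
    m / 2 * (b - a) * ‖(x a).2 - (y a).2‖ ^ 2 ≤
      inner ℝ ((x b).1 - (y b).1) ((x a).2 - (y a).2) := by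
  set v := (x a).2 - (y a).2 with hv
  have hxa : x a - y a = (0, v) := by
    refine Prod.ext ?_ rfl
    simpa using sub_eq_zero.2 hq
  have hnorm : ‖x a - y a‖ = ‖v‖ := by
    rw [hxa, Prod.norm_def, norm_zero, max_eq_right (norm_nonneg _)]
  have hder : ∀ s, HasDerivAt
      (fun s => inner ℝ ((x s).1 - (y s).1) v - s * (m / 2 * ‖v‖ ^ 2))
      (inner ℝ ((vectorField H s (x s)).1 - (vectorField H s (y s)).1) v - m / 2 * ‖v‖ ^ 2) s := by
    intro s
    have h1 := ((hx.hasDerivAt_fst s).fun_sub (hy.hasDerivAt_fst s)).inner ℝ (hasDerivAt_const s v)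
    have h2 := h1.fun_sub ((hasDerivAt_id' s).mul_const (m / 2 * ‖v‖ ^ 2))
    refine h2.congr_deriv ?_
    rw [inner_zero_right, zero_add, one_mul]
  have hmono : MonotoneOn
      (fun s => inner ℝ ((x s).1 - (y s).1) v - s * (m / 2 * ‖v‖ ^ 2)) (Icc a b) := by
    refine monotoneOn_of_deriv_nonneg (convex_Icc a b)
      (fun s _ => (hder s).continuousAt.continuousWithinAt)
      (fun s _ => (hder s).differentiableAt.differentiableWithinAt) fun s hsab => ?_
    rw [(hder s).deriv]
    rw [interior_Icc] at hsab
    have hd := hH.norm_orbit_drift_le_of_short hx hy hsab.1.le (by linarith [hsab.2])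
    rw [hnorm, hxa] at hd
    -- The point `w` differs from `y s` in momentum only, where strong monotonicity yields `m * ‖v‖
    -- ^ 2`. Passing from `w` to `x s` costs the drift, which is at most half of this.
    set w : Phase d := y s + (0, v) with hw
    have h1 : ‖vectorField H s (x s) - vectorField H s w‖ ≤ m / 2 * ‖v‖ := by
      refine (hH.norm_vectorField_sub_le' s _ _).trans ?_
      rwa [hw, ← sub_sub]
    have h2 : -(m / 2 * ‖v‖ ^ 2) ≤
        inner ℝ ((vectorField H s (x s)).1 - (vectorField H s w).1) v := by
      refine neg_le_of_abs_le ((abs_real_inner_le_norm _ _).trans ?_)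
      rw [pow_two, ← mul_assoc]
      exact mul_le_mul_of_nonneg_right
        ((norm_fst_le (vectorField H s (x s) - vectorField H s w)).trans h1) (norm_nonneg _)
    have h3 := hH.strong_monotone_p s (y s).1 (y s).2 ((y s).2 + v)
    rw [add_sub_cancel_left] at h3
    have h4 : ((y s).1, (y s).2 + v) = w := by simp [hw, Prod.ext_iff]
    rw [h4, Prod.mk.eta] at h3
    rw [inner_sub_left] at h2 h3 ⊢
    linarith
  have h := hmono (left_mem_Icc.2 hab) (right_mem_Icc.2 hab) hab
  simp only [sub_eq_zero.2 hq, inner_zero_left] at h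
  linarith

theorem IsAdmissible.momentum_sub_le (hH : IsAdmissible H m M)
    (hx : IsOrbit H x) (hy : IsOrbit H y) (hab : a ≤ b) (hs : b - a ≤ shortTime m M)
    (hq : (x a).1 = (y a).1) :
    m / 2 * (b - a) * ‖(x a).2 - (y a).2‖ ≤ ‖(x b).1 - (y b).1‖ := by
  have h := (hH.strong_monotone_endpoint hx hy hab hs hq).trans (real_inner_le_norm _ _)
  rcases (norm_nonneg ((x a).2 - (y a).2)).eq_or_lt with h0 | h0
  · rw [← h0, mul_zero]
    exact norm_nonneg _
  · rw [pow_two, ← mul_assoc] at h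
    exact le_of_mul_le_mul_right h h0

theorem IsAdmissible.orbit_eq_of_endpoints (hH : IsAdmissible H m M)
    (hx : IsOrbit H x) (hy : IsOrbit H y) (hab : a < b) (hs : b - a ≤ shortTime m M)
    (ha : (x a).1 = (y a).1) (hb : (x b).1 = (y b).1) : x = y := by
  have h := hH.momentum_sub_le hx hy hab.le hs ha
  rw [hb, sub_self, norm_zero] at h
  have hpos : 0 < m / 2 * (b - a) := mul_pos (half_pos hH.m_pos) (sub_pos.2 hab)
  have h0 : ‖(x a).2 - (y a).2‖ ≤ 0 := nonpos_of_mul_nonpos_right h hpos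
  exact hH.orbit_unique hx hy (s := a)
    (Prod.ext ha (sub_eq_zero.1 (norm_le_zero_iff.1 h0)))

/-- The final position is a Lipschitz and strongly monotone function of the initial momentum, hence
onto. -/
theorem IsAdmissible.exists_flow_eq (hH : IsAdmissible H m M) (hab : a < b)
    (hs : b - a ≤ shortTime m M) (q₀ q₁ : Conf d) : ∃ p : Conf d, (flow H a b (q₀, p)).1 = q₁ := by
  refine surjective_of_strongly_monotone (F := fun p => (flow H a b (q₀, p)).1)
    (L := Real.exp (M * |b - a|)) (mul_pos (half_pos hH.m_pos) (sub_pos.2 hab))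
    (fun p p' => ?_) (fun p p' => ?_) q₁
  · refine (norm_fst_le (flow H a b (q₀, p) - flow H a b (q₀, p'))).trans
      ((hH.norm_flow_sub_le a b _ _).trans (le_of_eq ?_))
    rw [Prod.mk_sub_mk, sub_self, Prod.norm_def, norm_zero, max_eq_right (norm_nonneg _), mul_comm]
  · have := hH.strong_monotone_endpoint (hH.isOrbit_flow a (q₀, p)) (hH.isOrbit_flow a (q₀, p'))
      hab.le hs (by rw [hH.flow_self, hH.flow_self])
    simpa only [hH.flow_self] using this

/-- The orbit which joins `q₀` at time `a` to `q₁` at time `b`, when `b - a` is short. -/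
noncomputable def joiningOrbit (H : ℝ × Conf d × Conf d → ℝ) (a b : ℝ) (q₀ q₁ : Conf d) :
    ℝ → Phase d :=
  fun s => flow H a s (q₀, initialMomentum H a b q₀ q₁)

theorem genFun_eq_joiningOrbit (q₀ q₁ : Conf d) :
    genFun H a b q₀ q₁ = action H a b (joiningOrbit H a b q₀ q₁) := rfl

theorem IsAdmissible.isOrbit_joiningOrbit (hH : IsAdmissible H m M) (q₀ q₁ : Conf d) :
    IsOrbit H (joiningOrbit H a b q₀ q₁) := hH.isOrbit_flow a _

theorem IsAdmissible.joiningOrbit_left (hH : IsAdmissible H m M) (q₀ q₁ : Conf d) :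
    (joiningOrbit H a b q₀ q₁ a).1 = q₀ := by
  rw [joiningOrbit, hH.flow_self]

theorem IsAdmissible.joiningOrbit_right (hH : IsAdmissible H m M) (hab : a < b)
    (hs : b - a ≤ shortTime m M) (q₀ q₁ : Conf d) : (joiningOrbit H a b q₀ q₁ b).1 = q₁ :=
  Classical.epsilon_spec (hH.exists_flow_eq hab hs q₀ q₁)

theorem IsAdmissible.genFun_orbit (hH : IsAdmissible H m M) (hx : IsOrbit H x) (hab : a < b)
    (hs : b - a ≤ shortTime m M) : genFun H a b (x a).1 (x b).1 = action H a b x := by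
  rw [genFun_eq_joiningOrbit, hH.orbit_eq_of_endpoints (hH.isOrbit_joiningOrbit _ _) hx hab hs
    (hH.joiningOrbit_left _ _) (hH.joiningOrbit_right hab hs _ _)]

/-- The initial state of an orbit depends in a Lipschitz way on its end positions. -/
theorem IsAdmissible.exists_norm_sub_le_endpoints (hH : IsAdmissible H m M) (hab : a < b)
    (hs : b - a ≤ shortTime m M) : ∃ C : ℝ, 0 ≤ C ∧ ∀ x y : ℝ → Phase d, IsOrbit H x →
      IsOrbit H y → ‖x a - y a‖ ≤ C * (‖(x a).1 - (y a).1‖ + ‖(x b).1 - (y b).1‖) := by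
  set c := m / 2 * (b - a) with hc
  have hc0 : 0 < c := mul_pos (half_pos hH.m_pos) (sub_pos.2 hab)
  set e := Real.exp (M * (b - a)) with he
  have he0 : 0 < e := Real.exp_pos _
  refine ⟨1 + (e + 1) / c, by positivity, fun x y hx hy => ?_⟩
  -- The intermediate orbit `w` separates the change of initial position, handled by Grönwall, from
  -- the change of initial momentum, handled by `momentum_sub_le`.
  set w : ℝ → Phase d := fun s => flow H a s ((y a).1, (x a).2) with hw
  have hwo : IsOrbit H w := hH.isOrbit_flow a _
  have hwa : w a = ((y a).1, (x a).2) := hH.flow_self a _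
  have h1 : ‖(x b).1 - (w b).1‖ ≤ ‖(x a).1 - (y a).1‖ * e := by
    refine (norm_fst_le (x b - w b)).trans ((hH.norm_orbit_sub_le_of_le hx hwo hab.le).trans ?_)
    refine mul_le_mul_of_nonneg_right (le_of_eq ?_) he0.le
    rw [hwa, Prod.norm_def, Prod.fst_sub, Prod.snd_sub, sub_self, norm_zero,
      max_eq_left (norm_nonneg _)]
  have h2 := hH.momentum_sub_le hwo hy hab.le hs (by rw [hwa])
  rw [hwa, ← hc] at h2
  have h3 : ‖(w b).1 - (y b).1‖ ≤ ‖(x b).1 - (w b).1‖ + ‖(x b).1 - (y b).1‖ := by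
    rw [norm_sub_rev (x b).1 (w b).1]
    exact norm_sub_le_norm_sub_add_norm_sub _ _ _
  set A := ‖(x a).1 - (y a).1‖
  set B := ‖(x b).1 - (y b).1‖
  have hA : 0 ≤ A := norm_nonneg _
  have hB : 0 ≤ B := norm_nonneg _
  have h4 : ‖(x a).2 - (y a).2‖ ≤ (e + 1) / c * (A + B) := by
    rw [div_mul_eq_mul_div, le_div_iff₀ hc0]
    nlinarith [mul_nonneg he0.le hB]
  have h5 : 0 ≤ (e + 1) / c * (A + B) := by positivity
  rw [Prod.norm_def]
  refine max_le ?_ ?_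
  · change A ≤ _
    linarith
  · change ‖(x a).2 - (y a).2‖ ≤ _
    linarith

/-- The difference of the actions of two orbits on the same interval. -/
theorem IsAdmissible.action_sub_ge (hH : IsAdmissible H m M)
    (hx : IsOrbit H x) (hy : IsOrbit H y) (hab : a ≤ b) {R : ℝ}
    (hR : ∀ s ∈ Icc a b, ‖x s - y s‖ ≤ R) :
    inner ℝ (y b).2 ((x b).1 - (y b).1) - inner ℝ (y a).2 ((x a).1 - (y a).1) -
      M * R ^ 2 * (b - a) ≤ action H a b x - action H a b y := by
  -- The boundary terms are the integral of this derivative, which reduces the claim to a pointwise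
  -- inequality between Lagrangians.
  have hder : ∀ s, HasDerivAt (fun s => inner ℝ (y s).2 ((x s).1 - (y s).1))
      (inner ℝ (y s).2 ((vectorField H s (x s)).1 - (vectorField H s (y s)).1) +
        inner ℝ (vectorField H s (y s)).2 ((x s).1 - (y s).1)) s := fun s =>
    (hy.hasDerivAt_snd s).inner ℝ ((hx.hasDerivAt_fst s).fun_sub (hy.hasDerivAt_fst s))
  have hcv : ∀ {z : ℝ → Phase d}, IsOrbit H z → Continuous fun s => vectorField H s (z s) := by
    intro z hz
    have h1 : Continuous (fun s => ((s, z s) : ℝ × Phase d)) := continuous_id.prodMk hz.continuous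
    have h2 := hH.continuous_vectorField
    have h3 := h2.comp h1
    exact h3
  have hcont : Continuous fun s =>
      (inner ℝ (y s).2 ((vectorField H s (x s)).1 - (vectorField H s (y s)).1) +
        inner ℝ (vectorField H s (y s)).2 ((x s).1 - (y s).1) : ℝ) :=
    (hy.continuous.snd.inner ((hcv hx).fst.sub (hcv hy).fst)).add
      ((hcv hy).snd.inner (hx.continuous.fst.sub hy.continuous.fst))
  have hlx := hx.continuous_lagrangian hH
  have hly := hy.continuous_lagrangian hH
  have hint : inner ℝ (y b).2 ((x b).1 - (y b).1) - inner ℝ (y a).2 ((x a).1 - (y a).1) =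
      ∫ s in a..b, (inner ℝ (y s).2 ((vectorField H s (x s)).1 - (vectorField H s (y s)).1) +
        inner ℝ (vectorField H s (y s)).2 ((x s).1 - (y s).1)) :=
    (intervalIntegral.integral_eq_sub_of_hasDerivAt (fun s _ => hder s)
      (hcont.intervalIntegrable a b)).symm
  have hconst : M * R ^ 2 * (b - a) = ∫ _ in a..b, M * R ^ 2 := by
    rw [intervalIntegral.integral_const, smul_eq_mul, mul_comm]
  rw [hint, hconst, hx.action_eq, hy.action_eq, ← intervalIntegral.integral_sub
    (hcont.intervalIntegrable a b) (continuous_const.intervalIntegrable a b),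
    ← intervalIntegral.integral_sub (hlx.intervalIntegrable a b) (hly.intervalIntegrable a b)]
  refine intervalIntegral.integral_mono_on hab
    ((hcont.sub continuous_const).intervalIntegrable a b)
    ((hlx.sub hly).intervalIntegrable a b) fun s hs => ?_
  -- By convexity in `p`, the Lagrangian along `x` is at least `⟨p_y, q̇_x⟩ - H(s, q_x, p_y)`.
  -- Expanding `H` in `q` around `q_y` then produces `ṗ_y` and the error `M * R ^ 2`.
  have h1 := hH.strong_convex_p s (x s).1 (x s).2 (y s).2
  have h2 := (abs_le.1 (hH.abs_taylor_q_le s (y s).1 (x s).1 (y s).2)).2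
  have h3 : M * ‖(x s).1 - (y s).1‖ ^ 2 ≤ M * R ^ 2 :=
    mul_le_mul_of_nonneg_left (pow_le_pow_left₀ (norm_nonneg _)
      ((norm_fst_le (x s - y s)).trans (hR s hs)) 2) hH.M_nonneg
  have h4 : 0 ≤ m / 2 * ‖(y s).2 - (x s).2‖ ^ 2 := by
    have := hH.m_pos
    positivity
  simp only [Prod.mk.eta] at h1 h2
  simp only [lagrangian]
  rw [inner_sub_right] at h1 ⊢
  rw [real_inner_comm, real_inner_comm (x s).2] at h1
  have e1 : H (s, (x s).1, (x s).2) = H (s, x s) := rfl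
  have e2 : H (s, (y s).1, (y s).2) = H (s, y s) := rfl
  rw [e1] at h1
  rw [e2] at h2
  linarith

/-- The generating function is semi-concave, with the momenta as a superdifferential. -/
theorem IsAdmissible.exists_action_semiconcave (hH : IsAdmissible H m M) (hab : a < b)
    (hs : b - a ≤ shortTime m M) : ∃ C : ℝ, 0 ≤ C ∧ ∀ x y : ℝ → Phase d, IsOrbit H x →
      IsOrbit H y → action H a b y - action H a b x ≤
        inner ℝ (x b).2 ((y b).1 - (x b).1) - inner ℝ (x a).2 ((y a).1 - (x a).1) +
          C * (‖(y a).1 - (x a).1‖ + ‖(y b).1 - (x b).1‖) ^ 2 := by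
  obtain ⟨C, hC, hlip⟩ := hH.exists_norm_sub_le_endpoints hab hs
  have hM := hH.M_nonneg
  have hba : 0 ≤ b - a := sub_nonneg.2 hab.le
  set e := Real.exp (M * (b - a)) with he
  have he1 : 1 ≤ e := Real.one_le_exp (mul_nonneg hM hba)
  refine ⟨2 * (C * e) + M * (C * e) ^ 2 * (b - a), by positivity, fun x y hx hy => ?_⟩
  have h1 := hlip y x hy hx
  set A := ‖(y a).1 - (x a).1‖ with hA
  set B := ‖(y b).1 - (x b).1‖ with hB
  have hA0 : 0 ≤ A := norm_nonneg _
  have hB0 : 0 ≤ B := norm_nonneg _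
  set R := C * (A + B) * e with hRdef
  have hR : ∀ s ∈ Icc a b, ‖y s - x s‖ ≤ R := fun s hs => by
    refine (hH.norm_orbit_sub_le_of_le hy hx hs.1).trans ?_
    have h3 : Real.exp (M * (s - a)) ≤ e :=
      Real.exp_le_exp.2 (mul_le_mul_of_nonneg_left (sub_le_sub_right hs.2 a) hM)
    exact mul_le_mul h1 h3 (Real.exp_pos _).le (by positivity)
  -- This bounds the action of `y` with the momenta of `y` as slopes; replacing them by those of `x`
  -- costs only the quadratic terms `R * B` and `R * A`.
  have h2 := hH.action_sub_ge hx hy hab.le (R := R)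
    (fun s hs => by rw [norm_sub_rev]; exact hR s hs)
  have hb : inner ℝ ((y b).2 - (x b).2) ((y b).1 - (x b).1) ≤ R * B :=
    (real_inner_le_norm _ _).trans (mul_le_mul_of_nonneg_right
      ((norm_snd_le (y b - x b)).trans (hR b (right_mem_Icc.2 hab.le))) hB0)
  have ha : -inner ℝ ((y a).2 - (x a).2) ((y a).1 - (x a).1) ≤ R * A :=
    (neg_le_abs _).trans ((abs_real_inner_le_norm _ _).trans (mul_le_mul_of_nonneg_right
      ((norm_snd_le (y a - x a)).trans (hR a (left_mem_Icc.2 hab.le))) hA0))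
  rw [inner_sub_left] at ha hb
  rw [← neg_sub (y b).1, ← neg_sub (y a).1, inner_neg_right, inner_neg_right] at h2
  have h3 : R * B + R * A + M * R ^ 2 * (b - a) ≤
      (2 * (C * e) + M * (C * e) ^ 2 * (b - a)) * (A + B) ^ 2 := by
    have h4 : 0 ≤ C * e * (A + B) ^ 2 := by positivity
    rw [hRdef]
    nlinarith
  linarith

/-- The initial state is a Lipschitz function of the end positions, and the action is continuous in
the initial state. -/
theorem IsAdmissible.continuous_genFun (hH : IsAdmissible H m M) (hab : a < b)
    (hs : b - a ≤ shortTime m M) :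
    Continuous (fun w : Conf d × Conf d => genFun H a b w.1 w.2) := by
  obtain ⟨C, hC, hlip⟩ := hH.exists_norm_sub_le_endpoints hab hs
  have hZ : LipschitzWith (C * 2).toNNReal
      (fun w : Conf d × Conf d => ((w.1, initialMomentum H a b w.1 w.2) : Phase d)) := by
    refine LipschitzWith.of_dist_le_mul fun w w' => ?_
    rw [dist_eq_norm, dist_eq_norm, Real.coe_toNNReal _ (by positivity)]
    have h := hlip _ _ (hH.isOrbit_joiningOrbit (a := a) (b := b) w.1 w.2)
      (hH.isOrbit_joiningOrbit (a := a) (b := b) w'.1 w'.2)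
    rw [hH.joiningOrbit_right hab hs, hH.joiningOrbit_right hab hs, hH.joiningOrbit_left,
      hH.joiningOrbit_left, joiningOrbit, joiningOrbit, hH.flow_self, hH.flow_self] at h
    refine h.trans ?_
    rw [mul_assoc]
    refine mul_le_mul_of_nonneg_left ?_ hC
    have h1 : ‖w.1 - w'.1‖ ≤ ‖w - w'‖ := norm_fst_le (w - w')
    have h2 : ‖w.2 - w'.2‖ ≤ ‖w - w'‖ := norm_snd_le (w - w')
    linarith
  have h2 := hH.continuous_action_flow a a b
  have h3 := h2.comp hZ.continuous
  exact h3

/-- The action of an orbit is coercive in its displacement. -/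
theorem IsAdmissible.action_ge (hH : IsAdmissible H m M) (hx : IsOrbit H x) (hab : a < b) :
    ‖(x b).1 - (x a).1‖ ^ 2 / (2 * (M + 1) * (b - a)) - (M + 1) * (b - a) ≤ action H a b x := by
  have hM := hH.M_nonneg
  have hba : 0 < b - a := sub_pos.2 hab
  set v := (x b).1 - (x a).1 with hv
  -- The Lagrangian is bounded below by convexity at a constant momentum `r`; this `r` maximizes
  -- `⟨r, v⟩ - (b - a) (M + 1) / 2 ‖r‖²`. Using `M + 1` avoids dividing by zero.
  set r := ((M + 1) * (b - a))⁻¹ • v with hr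
  have hder : ∀ s, HasDerivAt (fun s => inner ℝ r (x s).1)
      (inner ℝ r (vectorField H s (x s)).1) s := fun s => by
    have := (hasDerivAt_const s r).inner ℝ (hx.hasDerivAt_fst s)
    rwa [inner_zero_left, add_zero] at this
  have hcont : Continuous fun s => (inner ℝ r (vectorField H s (x s)).1 : ℝ) := by
    have h1 : Continuous (fun s => ((s, x s) : ℝ × Phase d)) := continuous_id.prodMk hx.continuous
    have h2 := hH.continuous_vectorField
    have h3 := h2.comp h1
    exact continuous_const.inner h3.fst
  have hint := intervalIntegral.integral_eq_sub_of_hasDerivAt (fun s _ => hder s)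
      (hcont.intervalIntegrable a b)
  set c := (M + 1) / 2 * ‖r‖ ^ 2 + (M + 1) with hc
  have hlow : (∫ s in a..b, (inner ℝ r (vectorField H s (x s)).1 - c)) ≤ action H a b x := by
    rw [hx.action_eq]
    refine intervalIntegral.integral_mono_on hab.le
      ((hcont.sub continuous_const).intervalIntegrable a b)
      ((hx.continuous_lagrangian hH).intervalIntegrable a b) fun s _ => ?_
    have h1 := hH.strong_convex_p s (x s).1 (x s).2 r
    have h2 := hH.growth_le s (x s).1 r
    have h4 : 0 ≤ m / 2 * ‖r - (x s).2‖ ^ 2 := by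
      have := hH.m_pos
      positivity
    simp only [Prod.mk.eta] at h1
    simp only [lagrangian]
    rw [inner_sub_right, real_inner_comm, real_inner_comm (x s).2] at h1
    have e1 : H (s, (x s).1, (x s).2) = H (s, x s) := rfl
    rw [e1] at h1
    rw [hc]
    nlinarith [sq_nonneg ‖r‖]
  rw [intervalIntegral.integral_sub (hcont.intervalIntegrable a b)
    (continuous_const.intervalIntegrable a b), hint, intervalIntegral.integral_const,
    smul_eq_mul, ← inner_sub_right, ← hv, hc, hr, real_inner_smul_left, norm_smul,
    real_inner_self_eq_norm_sq, Real.norm_eq_abs, abs_of_pos (by positivity)] at hlow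
  refine le_trans (le_of_eq ?_) hlow
  field_simp
  ring

end ShortTime

/-! ### A first order optimality condition. -/

section Superdifferential

variable {E : Type*} [NormedAddCommGroup E] [InnerProductSpace ℝ E]

/-- A linear form which is nonnegative up to a quadratic error vanishes. -/
theorem eq_zero_of_forall_inner_ge {v : E} {C : ℝ}
    (h : ∀ w : E, 0 ≤ inner ℝ v w + C * ‖w‖ ^ 2) : v = 0 := by
  have hpos : (0 : ℝ) < |C| + 1 := by positivity
  have h1 := h (-(|C| + 1)⁻¹ • v)
  rw [real_inner_smul_right, real_inner_self_eq_norm_sq, norm_smul, norm_neg, Real.norm_eq_abs,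
    abs_of_pos (inv_pos.2 hpos), mul_pow] at h1
  have h2 : C * ((|C| + 1)⁻¹ ^ 2 * ‖v‖ ^ 2) ≤ |C| * ((|C| + 1)⁻¹ ^ 2 * ‖v‖ ^ 2) :=
    mul_le_mul_of_nonneg_right (le_abs_self C) (by positivity)
  have h3 : (|C| + 1) * (|C| + 1)⁻¹ = 1 := mul_inv_cancel₀ hpos.ne'
  have h4 : 0 ≤ -((|C| + 1)⁻¹ ^ 2 * ‖v‖ ^ 2) := by
    calc (0 : ℝ) ≤ -(|C| + 1)⁻¹ * ‖v‖ ^ 2 + |C| * ((|C| + 1)⁻¹ ^ 2 * ‖v‖ ^ 2) := by linarith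
      _ = (-(|C| + 1)⁻¹ * ((|C| + 1) * (|C| + 1)⁻¹) + |C| * (|C| + 1)⁻¹ ^ 2) * ‖v‖ ^ 2 := by
        rw [h3]; ring
      _ = -((|C| + 1)⁻¹ ^ 2 * ‖v‖ ^ 2) := by ring
  have h5 : 0 < (|C| + 1)⁻¹ ^ 2 := by positivity
  have h6 : ‖v‖ ^ 2 ≤ 0 := by
    by_contra hv
    push Not at hv
    nlinarith [mul_pos h5 hv]
  exact norm_eq_zero.1 (pow_eq_zero_iff two_ne_zero |>.1 (le_antisymm h6 (sq_nonneg _)))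

end Superdifferential

/-! ### Minimizing broken orbits and their regularity. -/

section Chains

variable {d : ℕ} {H : ℝ × Conf d × Conf d → ℝ} {m M : ℝ} {τ t : ℝ} {n : ℕ}

theorem node_zero : node τ t n 0 = τ := by simp [node]

theorem node_self (hn : 0 < n) : node τ t n n = t := by
  have : (n : ℝ) ≠ 0 := by positivity
  rw [node, mul_div_cancel₀ _ this, add_sub_cancel]

theorem node_succ_sub (i : ℕ) : node τ t n (i + 1) - node τ t n i = (t - τ) / n := by
  simp only [node]
  push_cast
  ring

theorem node_lt_succ (hτ : τ < t) (hn : 0 < n) (i : ℕ) : node τ t n i < node τ t n (i + 1) := by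
  rw [← sub_pos, node_succ_sub]
  have := sub_pos.2 hτ
  positivity

theorem brokenAction_congr {θ θ' : ℕ → Conf d} (h : ∀ i ≤ n, θ i = θ' i) :
    brokenAction H τ t n θ = brokenAction H τ t n θ' := by
  refine Finset.sum_congr rfl fun i hi => ?_
  have hi' := Finset.mem_range.1 hi
  rw [h i hi'.le, h (i + 1) hi']

/-- An orbit defines a broken orbit with the same action. -/
theorem IsAdmissible.brokenAction_orbit (hH : IsAdmissible H m M) (hτ : τ < t) (hn : 0 < n)
    (hst : (t - τ) / n ≤ shortTime m M) {x : ℝ → Phase d} (hx : IsOrbit H x) {θ : ℕ → Conf d}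
    (hθ : ∀ i ≤ n, (x (node τ t n i)).1 = θ i) :
    brokenAction H τ t n θ = action H τ t x := by
  have h1 : ∀ i ∈ Finset.range n,
      genFun H (node τ t n i) (node τ t n (i + 1)) (θ i) (θ (i + 1)) =
        ∫ s in node τ t n i..node τ t n (i + 1), lagrangian H s (x s) := fun i hi => by
    have hi' := Finset.mem_range.1 hi
    rw [← hθ i hi'.le, ← hθ (i + 1) hi', hH.genFun_orbit hx (node_lt_succ hτ hn i)
      (by rwa [node_succ_sub]), hx.action_eq]
  rw [brokenAction, Finset.sum_congr rfl h1, intervalIntegral.sum_integral_adjacent_intervals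
    (fun i _ => (hx.continuous_lagrangian hH).intervalIntegrable _ _), node_zero, node_self hn,
    hx.action_eq]

theorem IsAdmissible.genFun_ge (hH : IsAdmissible H m M) {a b : ℝ} (hab : a < b)
    (hs : b - a ≤ shortTime m M) (q₀ q₁ : Conf d) :
    ‖q₁ - q₀‖ ^ 2 / (2 * (M + 1) * (b - a)) - (M + 1) * (b - a) ≤ genFun H a b q₀ q₁ := by
  have := hH.action_ge (hH.isOrbit_joiningOrbit (a := a) (b := b) q₀ q₁) hab
  rwa [hH.joiningOrbit_left, hH.joiningOrbit_right hab hs] at this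

/-- The chain with last point `q` which is prescribed before. -/
def chainTo (n : ℕ) (q : Conf d) (η : Fin n → Conf d) (i : ℕ) : Conf d :=
  if h : i < n then η ⟨i, h⟩ else q

theorem continuous_chainTo (q : Conf d) (i : ℕ) : Continuous fun η => chainTo n q η i := by
  unfold chainTo
  split_ifs with h
  · exact continuous_apply _
  · exact continuous_const

theorem chainTo_restrict {θ : ℕ → Conf d} {i : ℕ} (hi : i ≤ n) :
    chainTo n (θ n) (fun j => θ j) i = θ i := by
  unfold chainTo
  split_ifs with h
  · rfl
  · rw [le_antisymm hi (not_lt.1 h)]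

theorem IsAdmissible.continuous_brokenAction_chainTo (hH : IsAdmissible H m M) (hτ : τ < t)
    (hn : 0 < n) (hst : (t - τ) / n ≤ shortTime m M) (q : Conf d) :
    Continuous fun η : Fin n → Conf d => brokenAction H τ t n (chainTo n q η) := by
  refine continuous_finsetSum _ fun i _ => ?_
  have h1 : Continuous fun η : Fin n → Conf d => (chainTo n q η i, chainTo n q η (i + 1)) :=
    (continuous_chainTo q i).prodMk (continuous_chainTo q (i + 1))
  have h2 := hH.continuous_genFun (node_lt_succ hτ hn i) (by rwa [node_succ_sub])
  have h3 := h2.comp h1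
  exact h3

theorem dist_last_le_sum {θ : ℕ → Conf d} {i : ℕ} (hi : i ≤ n) :
    ‖θ i - θ n‖ ≤ ∑ j ∈ Finset.range n, ‖θ (j + 1) - θ j‖ := by
  rw [← dist_eq_norm]
  refine (dist_le_Ico_sum_dist θ hi).trans ?_
  simp only [dist_eq_norm, norm_sub_rev (θ _) (θ (_ + 1))]
  refine Finset.sum_le_sum_of_subset_of_nonneg (fun j hj => ?_) fun _ _ _ => norm_nonneg _
  exact Finset.mem_range.2 (Finset.mem_Ico.1 hj).2

/-- The broken action, plus a Lipschitz initial cost, is coercive. -/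
theorem IsAdmissible.exists_brokenAction_coercive (hH : IsAdmissible H m M) (hτ : τ < t)
    (hn : 0 < n) (hst : (t - τ) / n ≤ shortTime m M) {u : Conf d → ℝ} {k : NNReal}
    (hu : LipschitzWith k u) (q : Conf d) : ∃ B : ℝ, ∀ θ : ℕ → Conf d, θ n = q →
      (∑ j ∈ Finset.range n, ‖θ (j + 1) - θ j‖) - B ≤ u (θ 0) + brokenAction H τ t n θ := by
  set h := (t - τ) / n with hh
  have hM := hH.M_nonneg
  have h0 : 0 < h := by
    have := sub_pos.2 hτ
    positivity
  set c := 2 * (M + 1) * h with hc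
  have hc0 : 0 < c := by positivity
  -- By completing a square, each quadratic lower bound dominates a linear one of slope `k + 1`: the
  -- part `k` absorbs the variation of `u`, and the remaining `1` gives coercivity.
  refine ⟨n * ((M + 1) * h + (k + 1) ^ 2 * c / 4) - u q, fun θ hθ => ?_⟩
  have h1 : ∀ i ∈ Finset.range n, (k + 1) * ‖θ (i + 1) - θ i‖ -
      ((M + 1) * h + (k + 1) ^ 2 * c / 4) ≤
      genFun H (node τ t n i) (node τ t n (i + 1)) (θ i) (θ (i + 1)) := fun i _ => by
    have := hH.genFun_ge (node_lt_succ hτ hn i) (by rwa [node_succ_sub]) (θ i) (θ (i + 1))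
    rw [node_succ_sub, ← hh, ← hc] at this
    refine le_trans ?_ this
    have h2 : (k + 1) * ‖θ (i + 1) - θ i‖ ≤
        ‖θ (i + 1) - θ i‖ ^ 2 / c + (k + 1) ^ 2 * c / 4 := by
      rw [← sub_nonneg]
      have : ‖θ (i + 1) - θ i‖ ^ 2 / c + (k + 1) ^ 2 * c / 4 - (k + 1) * ‖θ (i + 1) - θ i‖ =
          (‖θ (i + 1) - θ i‖ - (k + 1) * c / 2) ^ 2 / c := by
        field_simp
        ring
      rw [this]
      positivity
    linarith
  have h2 := Finset.sum_le_sum h1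
  rw [Finset.sum_sub_distrib, ← Finset.mul_sum, Finset.sum_const, Finset.card_range,
    nsmul_eq_mul] at h2
  have h3 := dist_last_le_sum (θ := θ) (Nat.zero_le n)
  rw [hθ] at h3
  have h4 := (abs_le.1 (hu.norm_sub_le (θ 0) q)).1
  have h5 := mul_le_mul_of_nonneg_left h3 k.coe_nonneg
  rw [brokenAction]
  linarith

/-- A chain ending at `q` is given by its first `n` points, in a finite-dimensional space where a
continuous coercive function attains its minimum on closed sets. The set `D` serves both a free
initial point and a prescribed one. -/
theorem IsAdmissible.exists_min_chain (hH : IsAdmissible H m M) (hτ : τ < t)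
    (hn : 0 < n) (hst : (t - τ) / n ≤ shortTime m M) {u : Conf d → ℝ} {k : NNReal}
    (hu : LipschitzWith k u) {D : Set (Conf d)} (hD : IsClosed D) (hne : D.Nonempty)
    (q : Conf d) : ∃ θ : ℕ → Conf d, θ n = q ∧ θ 0 ∈ D ∧ ∀ θ' : ℕ → Conf d, θ' n = q → θ' 0 ∈ D →
      u (θ 0) + brokenAction H τ t n θ ≤ u (θ' 0) + brokenAction H τ t n θ' := by
  set F : (Fin n → Conf d) → ℝ :=
    fun η => u (chainTo n q η 0) + brokenAction H τ t n (chainTo n q η) with hF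
  have hFc : Continuous F := (hu.continuous.comp (continuous_chainTo q 0)).add
    (hH.continuous_brokenAction_chainTo hτ hn hst q)
  have hlast : ∀ η : Fin n → Conf d, chainTo n q η n = q := fun η => by simp [chainTo]
  obtain ⟨B, hB⟩ := hH.exists_brokenAction_coercive hτ hn hst hu q
  have hFge : ∀ η : Fin n → Conf d, ‖η‖ - (‖(fun _ => q : Fin n → Conf d)‖ + B) ≤ F η := by
    intro η
    have h1 := hB (chainTo n q η) (hlast η)
    have h2 : ‖η - fun _ => q‖ ≤
        ∑ j ∈ Finset.range n, ‖chainTo n q η (j + 1) - chainTo n q η j‖ := by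
      refine (pi_norm_le_iff_of_nonneg (Finset.sum_nonneg fun _ _ => norm_nonneg _)).2 fun i => ?_
      have h3 := dist_last_le_sum (θ := chainTo n q η) i.2.le
      rw [hlast] at h3
      simpa [chainTo] using h3
    have h4 := norm_sub_norm_le η (fun _ => q)
    simp only [hF]
    linarith
  have hFtop : Tendsto F (cocompact _) atTop := by
    refine tendsto_atTop_mono hFge ?_
    exact tendsto_atTop_add_const_right _ _ (tendsto_norm_cocompact_atTop (E := Fin n → Conf d))
  obtain ⟨q₀, hq₀⟩ := hne
  obtain ⟨η, hηD, hη⟩ := hFc.continuousOn.exists_isMinOn' (s := {η | chainTo n q η 0 ∈ D})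
    (x₀ := fun _ => q₀) (hD.preimage (continuous_chainTo q 0)) (by simpa [chainTo, hn] using hq₀)
    ((hFtop.eventually_ge_atTop _).filter_mono inf_le_left)
  refine ⟨chainTo n q η, hlast η, hηD, fun θ' hn' h0' => ?_⟩
  have hr : ∀ i ≤ n, chainTo n q (fun j => θ' j) i = θ' i := fun i hi => by
    rw [← hn']
    exact chainTo_restrict hi
  have h := hη (show (fun j : Fin n => θ' j) ∈ {η | chainTo n q η 0 ∈ D} by
    rw [mem_ofPred, hr 0 (Nat.zero_le n)]
    exact h0')
  simp only [mem_ofPred, hF] at h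
  rwa [brokenAction_congr hr, hr 0 (Nat.zero_le n)] at h

/-- The change of the broken action when one interior point is moved. -/
theorem brokenAction_update_sub {θ : ℕ → Conf d} {i : ℕ} (hi : i + 1 < n) (ζ : Conf d) :
    brokenAction H τ t n (Function.update θ (i + 1) ζ) - brokenAction H τ t n θ =
      (genFun H (node τ t n i) (node τ t n (i + 1)) (θ i) ζ -
        genFun H (node τ t n i) (node τ t n (i + 1)) (θ i) (θ (i + 1))) +
      (genFun H (node τ t n (i + 1)) (node τ t n (i + 2)) ζ (θ (i + 2)) -
        genFun H (node τ t n (i + 1)) (node τ t n (i + 2)) (θ (i + 1)) (θ (i + 2))) := by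
  rw [brokenAction, brokenAction, ← Finset.sum_sub_distrib,
    Finset.sum_eq_add i (i + 1) (by omega)]
  · simp
  · intro j _ hj
    rw [Function.update_of_ne hj.2, Function.update_of_ne (by omega), sub_self]
  · intro h
    exact absurd (Finset.mem_range.2 (by omega)) h
  · intro h
    exact absurd (Finset.mem_range.2 (by omega)) h

/-- The change of the broken action when the last point is moved. -/
theorem brokenAction_update_last_sub {θ : ℕ → Conf d} {i : ℕ} (ζ : Conf d) :
    brokenAction H τ t (i + 1) (Function.update θ (i + 1) ζ) - brokenAction H τ t (i + 1) θ =
      genFun H (node τ t (i + 1) i) (node τ t (i + 1) (i + 1)) (θ i) ζ -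
        genFun H (node τ t (i + 1) i) (node τ t (i + 1) (i + 1)) (θ i) (θ (i + 1)) := by
  rw [brokenAction, brokenAction, ← Finset.sum_sub_distrib, Finset.sum_eq_single i]
  · simp
  · intro j hj hji
    have := Finset.mem_range.1 hj
    rw [Function.update_of_ne (by omega), Function.update_of_ne (by omega), sub_self]
  · intro h
    exact absurd (Finset.mem_range.2 (by omega)) h

/-- The change of the broken action when the first point is moved. -/
theorem brokenAction_update_first_sub {θ : ℕ → Conf d} (hn : 0 < n) (ζ : Conf d) :
    brokenAction H τ t n (Function.update θ 0 ζ) - brokenAction H τ t n θ =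
      genFun H (node τ t n 0) (node τ t n 1) ζ (θ 1) -
        genFun H (node τ t n 0) (node τ t n 1) (θ 0) (θ 1) := by
  rw [brokenAction, brokenAction, ← Finset.sum_sub_distrib, Finset.sum_eq_single 0]
  · simp
  · intro j _ hj
    rw [Function.update_of_ne hj, Function.update_of_ne (by omega), sub_self]
  · intro h
    exact absurd (Finset.mem_range.2 hn) h

/-- Semi-concavity of the generating function in its second variable. -/
theorem IsAdmissible.exists_genFun_semiconcave_right (hH : IsAdmissible H m M) {a b : ℝ}
    (hab : a < b) (hs : b - a ≤ shortTime m M) : ∃ C : ℝ, ∀ x : ℝ → Phase d, IsOrbit H x →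
      ∀ ζ : Conf d, genFun H a b (x a).1 ζ - genFun H a b (x a).1 (x b).1 ≤
        inner ℝ (x b).2 (ζ - (x b).1) + C * ‖ζ - (x b).1‖ ^ 2 := by
  obtain ⟨C, -, hC⟩ := hH.exists_action_semiconcave hab hs
  refine ⟨C, fun x hx ζ => ?_⟩
  have h := hC x _ hx (hH.isOrbit_joiningOrbit (a := a) (b := b) (x a).1 ζ)
  rw [← genFun_eq_joiningOrbit, ← hH.genFun_orbit hx hab hs, hH.joiningOrbit_right hab hs,
    hH.joiningOrbit_left, sub_self, inner_zero_right, sub_zero, norm_zero, zero_add] at h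
  exact h

/-- Semi-concavity of the generating function in its first variable. -/
theorem IsAdmissible.exists_genFun_semiconcave_left (hH : IsAdmissible H m M) {a b : ℝ}
    (hab : a < b) (hs : b - a ≤ shortTime m M) : ∃ C : ℝ, ∀ x : ℝ → Phase d, IsOrbit H x →
      ∀ ζ : Conf d, genFun H a b ζ (x b).1 - genFun H a b (x a).1 (x b).1 ≤
        -inner ℝ (x a).2 (ζ - (x a).1) + C * ‖ζ - (x a).1‖ ^ 2 := by
  obtain ⟨C, -, hC⟩ := hH.exists_action_semiconcave hab hs
  refine ⟨C, fun x hx ζ => ?_⟩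
  have h := hC x _ hx (hH.isOrbit_joiningOrbit (a := a) (b := b) ζ (x b).1)
  rw [← genFun_eq_joiningOrbit, ← hH.genFun_orbit hx hab hs, hH.joiningOrbit_right hab hs,
    hH.joiningOrbit_left, sub_self, inner_zero_right, zero_sub, norm_zero, add_zero] at h
  exact h

/-- A broken orbit which minimizes the action with fixed ends is an orbit. -/
theorem IsAdmissible.exists_orbit_of_min_chain (hH : IsAdmissible H m M) (hτ : τ < t)
    (hn : 0 < n) (hst : (t - τ) / n ≤ shortTime m M) {θ : ℕ → Conf d}
    (hmin : ∀ θ' : ℕ → Conf d, θ' 0 = θ 0 → θ' n = θ n →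
      brokenAction H τ t n θ ≤ brokenAction H τ t n θ') :
    ∃ x : ℝ → Phase d, IsOrbit H x ∧ ∀ i ≤ n, (x (node τ t n i)).1 = θ i := by
  have hlt := node_lt_succ hτ hn
  have hsh : ∀ i, node τ t n (i + 1) - node τ t n i ≤ shortTime m M := fun i => by
    rwa [node_succ_sub]
  set y : ℕ → ℝ → Phase d :=
    fun i => joiningOrbit H (node τ t n i) (node τ t n (i + 1)) (θ i) (θ (i + 1)) with hy
  have hyo : ∀ i, IsOrbit H (y i) := fun i => hH.isOrbit_joiningOrbit _ _
  have hyl : ∀ i, (y i (node τ t n i)).1 = θ i := fun i => hH.joiningOrbit_left _ _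
  have hyr : ∀ i, (y i (node τ t n (i + 1))).1 = θ (i + 1) := fun i =>
    hH.joiningOrbit_right (hlt i) (hsh i) _ _
  have hstep : ∀ i, i + 1 < n → y (i + 1) = y i := by
    intro i hi
    obtain ⟨C, hC⟩ := hH.exists_genFun_semiconcave_right (hlt i) (hsh i)
    obtain ⟨C', hC'⟩ := hH.exists_genFun_semiconcave_left (hlt (i + 1)) (hsh (i + 1))
    refine hH.orbit_unique (hyo _) (hyo _) (s := node τ t n (i + 1))
      (Prod.ext ((hyl _).trans (hyr _).symm) ?_)
    -- Moving a corner by `w` changes the action by at most `⟨p⁻ - p⁺, w⟩ + (C + C') ‖w‖²`, with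
    -- `p⁻` and `p⁺` the momenta on its two sides. Minimality makes this nonnegative for all `w`, so
    -- the momenta agree; no differentiability of `genFun` is needed.
    refine (sub_eq_zero.1 (eq_zero_of_forall_inner_ge (C := C + C') fun w => ?_)).symm
    have h1 := hmin (Function.update θ (i + 1) (θ (i + 1) + w))
      (Function.update_of_ne (by omega) _ _) (Function.update_of_ne (by omega) _ _)
    have h2 := brokenAction_update_sub (H := H) (τ := τ) (t := t) (θ := θ) hi (θ (i + 1) + w)
    have h3 := hC (y i) (hyo i) (θ (i + 1) + w)
    have h4 := hC' (y (i + 1)) (hyo (i + 1)) (θ (i + 1) + w)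
    rw [hyl, hyr, add_sub_cancel_left] at h3 h4
    rw [inner_sub_left]
    linarith
  have hall : ∀ i, i < n → y i = y 0 := by
    intro i
    induction i with
    | zero => exact fun _ => rfl
    | succ i ih => exact fun hi => (hstep i hi).trans (ih (by omega))
  refine ⟨y 0, hyo 0, fun i hi => ?_⟩
  rcases hi.lt_or_eq with h | h
  · rw [← hall i h]
    exact hyl i
  · obtain ⟨j, rfl⟩ : ∃ j, n = j + 1 := ⟨n - 1, by omega⟩
    rw [h, ← hall j (by omega)]
    exact hyr j

/-- The minimum over broken orbits is the least action of the orbits with the same ends. -/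
theorem IsAdmissible.isLeast_brokenMin (hH : IsAdmissible H m M) (hτ : τ < t)
    (hn : 0 < n) (hst : (t - τ) / n ≤ shortTime m M) (q₀ q₁ : Conf d) :
    IsLeast {A | ∃ x : ℝ → Phase d, IsOrbit H x ∧ (x τ).1 = q₀ ∧ (x t).1 = q₁ ∧
      action H τ t x = A} (brokenMin H n τ t q₀ q₁) := by
  obtain ⟨θ, hθn, hθ0, hmin⟩ := hH.exists_min_chain hτ hn hst (u := fun _ => 0)
    (LipschitzWith.const 0) (isClosed_singleton (x := q₀)) (singleton_nonempty q₀) q₁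
  rw [mem_singleton_iff] at hθ0
  simp only [zero_add, mem_singleton_iff] at hmin
  have : Nonempty {θ : ℕ → Conf d // θ 0 = q₀ ∧ θ n = q₁} := ⟨⟨θ, hθ0, hθn⟩⟩
  have hmin' : ∀ θ' : {θ : ℕ → Conf d // θ 0 = q₀ ∧ θ n = q₁},
      brokenAction H τ t n θ ≤ brokenAction H τ t n θ'.1 := fun θ' => hmin _ θ'.2.2 θ'.2.1
  have heq : brokenMin H n τ t q₀ q₁ = brokenAction H τ t n θ :=
    le_antisymm (ciInf_le (f := fun θ' : {θ : ℕ → Conf d // θ 0 = q₀ ∧ θ n = q₁} =>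
      brokenAction H τ t n θ'.1) ⟨_, forall_mem_range.2 hmin'⟩ ⟨θ, hθ0, hθn⟩) (le_ciInf hmin')
  rw [heq]
  constructor
  · obtain ⟨x, hx, hxθ⟩ := hH.exists_orbit_of_min_chain hτ hn hst (θ := θ)
      fun θ' h0 hn' => hmin θ' (hn'.trans hθn) (h0.trans hθ0)
    refine ⟨x, hx, ?_, ?_, (hH.brokenAction_orbit hτ hn hst hx hxθ).symm⟩
    · rw [← hθ0, ← hxθ 0 (Nat.zero_le n), node_zero]
    · rw [← hθn, ← hxθ n le_rfl, node_self hn]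
  · rintro A ⟨x, hx, h0, h1, rfl⟩
    rw [← hH.brokenAction_orbit hτ hn hst hx (θ := fun i => (x (node τ t n i)).1)
      fun i _ => rfl]
    exact hmin _ (by rw [node_self hn, h1]) (by rw [node_zero, h0])

theorem IsAdmissible.exists_short_step (hH : IsAdmissible H m M) (τ t : ℝ) {σ : ℝ} (hσ : 0 < σ) :
    ∃ n : ℕ, 0 < n ∧ (t - τ) / n < σ ∧ (t - τ) / n ≤ shortTime m M := by
  have hpos : 0 < min σ (shortTime m M) := lt_min hσ (shortTime_pos hH.m_pos)
  have h := ((tendsto_const_div_atTop_nhds_zero_nat (t - τ)).eventually_lt_const hpos).and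
    (eventually_gt_atTop 0)
  obtain ⟨n, h1, h2⟩ := h.exists
  exact ⟨n, h2, h1.trans_le (min_le_left _ _), h1.le.trans (min_le_right _ _)⟩

/-- The least action among orbits with given ends does not involve the subdivision, so all fine
subdivisions give the same minimum. -/
theorem IsAdmissible.minAction_eq_brokenMin (hH : IsAdmissible H m M) (hτ : τ < t)
    (hn : 0 < n) (hst : (t - τ) / n ≤ shortTime m M) (q₀ q₁ : Conf d) :
    minAction H τ t q₀ q₁ = brokenMin H n τ t q₀ q₁ := by
  have hspec : ∃ σ : ℝ, 0 < σ ∧ ∀ n : ℕ, 0 < n → (t - τ) / n < σ →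
      brokenMin H n τ t q₀ q₁ = minAction H τ t q₀ q₁ :=
    Classical.epsilon_spec (p := fun a : ℝ => ∃ σ : ℝ, 0 < σ ∧
      ∀ n : ℕ, 0 < n → (t - τ) / n < σ → brokenMin H n τ t q₀ q₁ = a)
      ⟨brokenMin H n τ t q₀ q₁, shortTime m M, shortTime_pos hH.m_pos, fun n' hn' hst' =>
        (hH.isLeast_brokenMin hτ hn' hst'.le q₀ q₁).unique (hH.isLeast_brokenMin hτ hn hst q₀ q₁)⟩
  obtain ⟨σ, hσ, h⟩ := hspec
  -- The threshold `σ` is unknown, so the comparison goes through a subdivision finer than both `σ`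
  -- and `shortTime m M`.
  obtain ⟨n', hn', h1, h2⟩ := hH.exists_short_step τ t hσ
  rw [← h n' hn' h1]
  exact (hH.isLeast_brokenMin hτ hn' h2 q₀ q₁).unique (hH.isLeast_brokenMin hτ hn hst q₀ q₁)

end Chains

/-! ### Functions squeezed between paraboloids. -/

section QuadraticBounds

variable {E : Type*} [NormedAddCommGroup E] [InnerProductSpace ℝ E] {u : E → ℝ} {x y p p' : E}
  {C : ℝ}

/-- A semi-concave function which has a quadratic lower bound at `x` with linear part `p` also has
the quadratic upper bound with linear part `p`. -/
theorem quadratic_upper_bound_of_lower_bound {K : ℝ}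
    (hu : ConcaveOn ℝ univ fun θ : E => u θ - K * ‖θ‖ ^ 2)
    (h : ∀ ζ, inner ℝ p (ζ - x) - C * ‖ζ - x‖ ^ 2 ≤ u ζ - u x) (ζ : E) :
    u ζ - u x ≤ inner ℝ p (ζ - x) + K * ‖ζ - x‖ ^ 2 := by
  set w := ζ - x with hw
  have hζ : ζ = x + w := by rw [hw]; abel
  -- The point `x` is a convex combination of `ζ` and `x - s • w`, so concavity and the lower bound
  -- at `x - s • w` bound `u ζ` from above. The error is of order `s`, and `s` tends to zero.
  have key : ∀ s ∈ Ioi (0 : ℝ),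
      u ζ - u x - inner ℝ p w - K * ‖w‖ ^ 2 ≤ s * ((C + K) * ‖w‖ ^ 2) := by
    intro s hs
    have hs0 : (0 : ℝ) < s := hs
    have h1 := hu.2 (mem_univ ζ) (mem_univ (x - s • w)) (by positivity : 0 ≤ s / (1 + s))
      (by positivity : 0 ≤ 1 / (1 + s)) (by field_simp; ring)
    have h2 : (s / (1 + s)) • ζ + (1 / (1 + s)) • (x - s • w) = x := by
      rw [hζ]
      have e1 : (s / (1 + s)) • (x + w) + (1 / (1 + s)) • (x - s • w) =
          (s / (1 + s) + 1 / (1 + s)) • x + (s / (1 + s) - 1 / (1 + s) * s) • w := by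
        module
      have e2 : s / (1 + s) + 1 / (1 + s) = 1 := by field_simp; ring
      have e3 : s / (1 + s) - 1 / (1 + s) * s = 0 := by field_simp; ring
      rw [e1, e2, e3, one_smul, zero_smul, add_zero]
    simp only [h2, smul_eq_mul] at h1
    have h3 := h (x - s • w)
    rw [sub_sub_cancel_left, inner_neg_right, real_inner_smul_right, norm_neg, norm_smul,
      Real.norm_eq_abs, abs_of_pos hs0] at h3
    have h4 : ‖x - s • w‖ ^ 2 = ‖x‖ ^ 2 - 2 * (s * inner ℝ x w) + s ^ 2 * ‖w‖ ^ 2 := by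
      rw [norm_sub_sq_real, real_inner_smul_right, norm_smul, Real.norm_eq_abs, abs_of_pos hs0,
        mul_pow]
    have h5 : ‖ζ‖ ^ 2 = ‖x‖ ^ 2 + 2 * inner ℝ x w + ‖w‖ ^ 2 := by
      rw [hζ, norm_add_sq_real]
    rw [h4, h5] at h1
    have h6 : s * (u ζ - K * (‖x‖ ^ 2 + 2 * inner ℝ x w + ‖w‖ ^ 2)) +
        (u (x - s • w) - K * (‖x‖ ^ 2 - 2 * (s * inner ℝ x w) + s ^ 2 * ‖w‖ ^ 2)) ≤
        (1 + s) * (u x - K * ‖x‖ ^ 2) := by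
      refine le_trans (le_of_eq ?_) (mul_le_mul_of_nonneg_left h1 (by positivity : 0 ≤ 1 + s))
      field_simp
    refine le_of_mul_le_mul_left ?_ hs0
    nlinarith
  have hlim : Tendsto (fun s : ℝ => s * ((C + K) * ‖w‖ ^ 2)) (𝓝[>] 0) (𝓝 0) := by
    have : Tendsto (fun s : ℝ => s * ((C + K) * ‖w‖ ^ 2)) (𝓝 0) (𝓝 (0 * ((C + K) * ‖w‖ ^ 2))) :=
      (continuous_id.mul continuous_const).tendsto 0
    rw [zero_mul] at this
    exact this.mono_left nhdsWithin_le_nhds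
  have := ge_of_tendsto hlim (eventually_mem_nhdsWithin.mono key)
  linarith

/-- Two-sided quadratic bounds at two points control the difference of the linear parts. -/
theorem norm_sub_le_of_quadratic_bounds (hC : 0 ≤ C)
    (hx : ∀ ζ, |u ζ - u x - inner ℝ p (ζ - x)| ≤ C * ‖ζ - x‖ ^ 2)
    (hy : ∀ ζ, |u ζ - u y - inner ℝ p' (ζ - y)| ≤ C * ‖ζ - y‖ ^ 2) :
    ‖p - p'‖ ≤ (6 * C + 1) * ‖x - y‖ := by
  set v := p - p' with hv
  -- Comparing both expansions at `y + s • v` gives `s‖v‖² ≤ 3C‖x - y‖² + 3C s²‖v‖²`; this `s` lets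
  -- the left side absorb the last term.
  set s := 1 / (6 * C + 1) with hs
  have hs0 : 0 < s := by positivity
  have hs1 : s * (6 * C + 1) = 1 := by rw [hs]; field_simp
  have h1 := (abs_le.1 (hx y)).2
  have h2 := (abs_le.1 (hy (y + s • v))).2
  have h3 := (abs_le.1 (hx (y + s • v))).1
  rw [add_sub_cancel_left, norm_smul, Real.norm_eq_abs, abs_of_pos hs0] at h2
  have e1 : y + s • v - x = (y - x) + s • v := by abel
  have e2 : inner ℝ p (s • v) - inner ℝ p' (s • v) = s * ‖v‖ ^ 2 := by
    rw [← inner_sub_left, ← hv, real_inner_smul_right, real_inner_self_eq_norm_sq]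
  have h4 : ‖(y - x) + s • v‖ ^ 2 ≤ 2 * (‖x - y‖ ^ 2 + (s * ‖v‖) ^ 2) := by
    have := norm_add_le (y - x) (s • v)
    rw [norm_smul, Real.norm_eq_abs, abs_of_pos hs0, norm_sub_rev y x] at this
    refine (pow_le_pow_left₀ (norm_nonneg _) this 2).trans ?_
    nlinarith [sq_nonneg (‖x - y‖ - s * ‖v‖)]
  have h5 := mul_le_mul_of_nonneg_left h4 hC
  rw [e1, inner_add_right] at h3
  rw [norm_sub_rev y x] at h1
  have h6 : s * ‖v‖ ^ 2 ≤ 3 * C * ‖x - y‖ ^ 2 + 3 * C * (s * ‖v‖) ^ 2 := by linarith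
  have h7 : 3 * C * s ≤ 1 / 2 := by linarith
  have h8 : 3 * C * (s * ‖v‖) ^ 2 ≤ 1 / 2 * (s * ‖v‖ ^ 2) := by
    calc 3 * C * (s * ‖v‖) ^ 2 = 3 * C * s * (s * ‖v‖ ^ 2) := by ring
      _ ≤ _ := mul_le_mul_of_nonneg_right h7 (by positivity)
  have h9 : s * ‖v‖ ^ 2 ≤ 6 * C * ‖x - y‖ ^ 2 := by linarith
  have h10 : ‖v‖ ^ 2 ≤ (6 * C + 1) * (6 * C * ‖x - y‖ ^ 2) := by
    calc ‖v‖ ^ 2 = s * (6 * C + 1) * ‖v‖ ^ 2 := by rw [hs1, one_mul]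
      _ = (6 * C + 1) * (s * ‖v‖ ^ 2) := by ring
      _ ≤ _ := mul_le_mul_of_nonneg_left h9 (by positivity)
  refine le_of_sq_le_sq (h10.trans ?_) (by positivity)
  nlinarith [mul_nonneg (by positivity : 0 ≤ 6 * C + 1) (sq_nonneg ‖x - y‖)]

theorem hasGradientAt_of_quadratic_bounds [CompleteSpace E]
    (hx : ∀ ζ, |u ζ - u x - inner ℝ p (ζ - x)| ≤ C * ‖ζ - x‖ ^ 2) : HasGradientAt u p x := by
  have h1 : (fun ζ => u ζ - u x - inner ℝ p (ζ - x)) =O[𝓝 x] fun ζ => ‖ζ - x‖ ^ 2 :=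
    Asymptotics.IsBigO.of_bound C (Eventually.of_forall fun ζ => by
      rw [Real.norm_eq_abs, Real.norm_of_nonneg (by positivity)]
      exact hx ζ)
  have h2 := h1.hasFDerivAt (𝕜 := ℝ) one_lt_two
  have h3 : HasFDerivAt (fun ζ => inner ℝ p (ζ - x)) (InnerProductSpace.toDual ℝ E p) x := by
    have := ((InnerProductSpace.toDual ℝ E p).hasFDerivAt (x := x)).sub_const (inner ℝ p x)
    refine this.congr_of_eventuallyEq (Eventually.of_forall fun ζ => ?_)
    simp only [inner_sub_right, InnerProductSpace.toDual_apply_apply]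
  rw [hasGradientAt_iff_hasFDerivAt]
  have h4 := (h2.fun_add h3).add_const (u x)
  rw [zero_add] at h4
  refine h4.congr_of_eventuallyEq (Eventually.of_forall fun ζ => ?_)
  ring

/-- The paraboloid minus `u` has a minimum at `x`, where its derivative must vanish. -/
theorem HasGradientAt.eq_of_quadratic_upper_bound [CompleteSpace E] (h : HasGradientAt u p' x)
    (hx : ∀ ζ, u ζ - u x ≤ inner ℝ p (ζ - x) + C * ‖ζ - x‖ ^ 2) : p = p' := by
  have h1 : HasGradientAt (fun ζ => inner ℝ p (ζ - x) + C * ‖ζ - x‖ ^ 2) p x :=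
    hasGradientAt_of_quadratic_bounds (C := |C|) fun ζ => by
      simp [abs_mul]
  have h2 := (hasGradientAt_iff_hasFDerivAt.1 h1).fun_sub (hasGradientAt_iff_hasFDerivAt.1 h)
  have h3 : IsLocalMin (fun ζ => inner ℝ p (ζ - x) + C * ‖ζ - x‖ ^ 2 - u ζ) x :=
    Eventually.of_forall fun ζ => by
      have := hx ζ
      simp only [sub_self, inner_zero_right, norm_zero]
      simp only [ne_eq, OfNat.ofNat_ne_zero, not_false_eq_true, zero_pow, mul_zero, add_zero]
      linarith
  exact (InnerProductSpace.toDual ℝ E).injective (sub_eq_zero.1 (h3.hasFDerivAt_eq_zero h2))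

end QuadraticBounds

/-! ### Calibrated orbits of the Lax-Oleinik operator. -/

section Calibrated

variable {d : ℕ} {H : ℝ × Conf d × Conf d → ℝ} {m M : ℝ} {τ t : ℝ} {n : ℕ} {u : Conf d → ℝ}
  {k : NNReal}

/-- The infimum in the Lax-Oleinik operator is a minimum, realized by an orbit. -/
theorem IsAdmissible.exists_minimizing_orbit (hH : IsAdmissible H m M) (hτ : τ < t)
    (hn : 0 < n) (hst : (t - τ) / n ≤ shortTime m M) (hu : LipschitzWith k u) (q : Conf d) :
    (∃ x : ℝ → Phase d, IsOrbit H x ∧ (x t).1 = q ∧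
      u (x τ).1 + action H τ t x = laxOleinik H τ t u q) ∧
    ∀ θ : ℕ → Conf d, θ n = q → laxOleinik H τ t u q ≤ u (θ 0) + brokenAction H τ t n θ := by
  obtain ⟨θ, hθn, -, hmin⟩ := hH.exists_min_chain hτ hn hst hu isClosed_univ univ_nonempty q
  have hmin' : ∀ θ' : ℕ → Conf d, θ' n = q →
      u (θ 0) + brokenAction H τ t n θ ≤ u (θ' 0) + brokenAction H τ t n θ' :=
    fun θ' h => hmin θ' h (mem_univ _)
  obtain ⟨x, hx, hxθ⟩ := hH.exists_orbit_of_min_chain hτ hn hst (θ := θ) fun θ' h0 hn' => by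
    have := hmin' θ' (hn'.trans hθn)
    rw [h0] at this
    linarith
  have hx0 : (x τ).1 = θ 0 := by rw [← hxθ 0 (Nat.zero_le n), node_zero]
  have hxt : (x t).1 = q := by rw [← hθn, ← hxθ n le_rfl, node_self hn]
  have hxa := hH.brokenAction_orbit hτ hn hst hx hxθ
  have hle : ∀ ϑ : Conf d,
      u (θ 0) + brokenAction H τ t n θ ≤ u ϑ + minAction H τ t ϑ q := fun ϑ => by
    rw [hH.minAction_eq_brokenMin hτ hn hst]
    obtain ⟨y, hy, hy0, hyt, hya⟩ := (hH.isLeast_brokenMin hτ hn hst ϑ q).1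
    rw [← hya, ← hH.brokenAction_orbit hτ hn hst hy (θ := fun i => (y (node τ t n i)).1)
      fun _ _ => rfl]
    have := hmin' (fun i => (y (node τ t n i)).1) (by rw [node_self hn, hyt])
    simpa only [node_zero, hy0] using this
  have heq : laxOleinik H τ t u q = u (θ 0) + brokenAction H τ t n θ := by
    refine le_antisymm ((ciInf_le ⟨_, forall_mem_range.2 hle⟩ (θ 0)).trans ?_) (le_ciInf hle)
    rw [hH.minAction_eq_brokenMin hτ hn hst]
    refine add_le_add le_rfl ?_
    rw [hxa]
    exact (hH.isLeast_brokenMin hτ hn hst (θ 0) q).2 ⟨x, hx, hx0, hxt, rfl⟩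
  refine ⟨⟨x, hx, hxt, ?_⟩, fun θ' h => ?_⟩
  · rw [heq, hx0, hxa]
  · rw [heq]
    exact hmin' θ' h

/-- The points at time `t` of the orbits which realize the minimum in the Lax-Oleinik operator. -/
def calibratedSet (H : ℝ × Conf d × Conf d → ℝ) (τ t : ℝ) (u : Conf d → ℝ) : Set (Phase d) :=
  {z | u (flow H t τ z).1 + action H τ t (fun s => flow H t s z) = laxOleinik H τ t u z.1}

theorem IsAdmissible.laxOleinik_le_orbit (hH : IsAdmissible H m M) (hτ : τ < t)
    (hu : LipschitzWith k u) {x : ℝ → Phase d} (hx : IsOrbit H x) :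
    laxOleinik H τ t u (x t).1 ≤ u (x τ).1 + action H τ t x := by
  obtain ⟨n, hn, -, hst⟩ := hH.exists_short_step τ t one_pos
  have h := (hH.exists_minimizing_orbit hτ hn hst hu (x t).1).2
    (fun i => (x (node τ t n i)).1) (by rw [node_self hn])
  rwa [hH.brokenAction_orbit hτ hn hst hx fun _ _ => rfl, node_zero] at h

/-- No continuity of the Lax-Oleinik image is needed: its value over `z.1` is the minimum over `p`
of the cost of the orbit ending at `(z.1, p)`. Calibration thus amounts to a family of closed
inequalities indexed by `p`. -/
theorem IsAdmissible.isClosed_calibratedSet (hH : IsAdmissible H m M) (hτ : τ < t)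
    (hu : LipschitzWith k u) : IsClosed (calibratedSet H τ t u) := by
  have hW : Continuous fun z : Phase d =>
      u (flow H t τ z).1 + action H τ t (fun s => flow H t s z) := by
    have h1 := hH.continuous_flow t
    have h2 : Continuous fun z : Phase d => (z, τ) := continuous_id.prodMk continuous_const
    have h3 := h1.comp h2
    exact (hu.continuous.comp h3.fst).add (hH.continuous_action_flow t τ t)
  have heq : calibratedSet H τ t u = ⋂ p : Conf d, {z : Phase d |
      u (flow H t τ z).1 + action H τ t (fun s => flow H t s z) ≤
        u (flow H t τ (z.1, p)).1 + action H τ t (fun s => flow H t s (z.1, p))} := by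
    ext z
    rw [mem_iInter]
    constructor
    · intro hz p
      have h := hH.laxOleinik_le_orbit hτ hu (hH.isOrbit_flow t (z.1, p))
      rw [hH.flow_self] at h
      exact (show _ = _ from hz).trans_le h
    · intro hz
      obtain ⟨n, hn, -, hst⟩ := hH.exists_short_step τ t one_pos
      obtain ⟨x, hx, hxt, hxa⟩ := (hH.exists_minimizing_orbit hτ hn hst hu z.1).1
      have h1 := hH.laxOleinik_le_orbit hτ hu (hH.isOrbit_flow t z)
      rw [hH.flow_self] at h1
      refine le_antisymm ?_ h1
      have h2 := hz (x t).2
      have h3 : (z.1, (x t).2) = x t := Prod.ext hxt.symm rfl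
      simp only [mem_ofPred, h3, hH.flow_orbit hx] at h2
      rw [← hxa]
      exact h2
  rw [heq]
  refine isClosed_iInter fun p => isClosed_le hW ?_
  have h2 : Continuous fun z : Phase d => (z.1, p) := continuous_fst.prodMk continuous_const
  have h3 := hW.comp h2
  exact h3

theorem IsAdmissible.diffGraph_subset_calibratedSet (hH : IsAdmissible H m M) (hτ : τ < t)
    (hu : LipschitzWith k u) : diffGraph (laxOleinik H τ t u) ⊆ calibratedSet H τ t u := by
  intro z hz
  obtain ⟨n, hn, -, hst⟩ := hH.exists_short_step τ t one_pos
  obtain ⟨i, rfl⟩ : ∃ i, n = i + 1 := ⟨n - 1, by omega⟩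
  obtain ⟨⟨x, hx, hxt, hxa⟩, -⟩ := hH.exists_minimizing_orbit hτ hn hst hu z.1
  have hlt := node_lt_succ hτ hn i
  have hsh : node τ t (i + 1) (i + 1) - node τ t (i + 1) i ≤ shortTime m M := by
    rwa [node_succ_sub]
  obtain ⟨C, hC⟩ := hH.exists_genFun_semiconcave_right hlt hsh
  -- Moving only the last point of the minimizing chain bounds the Lax-Oleinik image above by a
  -- paraboloid of slope `(x t).2`, which must equal the gradient.
  have hp : (x t).2 = z.2 := by
    refine HasGradientAt.eq_of_quadratic_upper_bound (C := C)
      (show HasGradientAt (laxOleinik H τ t u) z.2 z.1 from hz) fun ζ => ?_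
    set θ : ℕ → Conf d := fun j => (x (node τ t (i + 1) j)).1 with hθ
    have h1 := (hH.exists_minimizing_orbit hτ hn hst hu ζ).2
      (Function.update θ (i + 1) ζ) (Function.update_self _ _ _)
    have h2 := brokenAction_update_last_sub (H := H) (τ := τ) (t := t) (θ := θ) (i := i) ζ
    have h3 := hC x hx ζ
    have h4 := hH.brokenAction_orbit hτ hn hst hx (θ := θ) fun _ _ => rfl
    have hθ0 : θ 0 = (x τ).1 := by rw [hθ]; simp only [node_zero]
    have hnode : node τ t (i + 1) (i + 1) = t := node_self hn
    rw [Function.update_of_ne (by omega), hθ0] at h1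
    simp only [hθ] at h1 h2 h3 h4
    rw [hnode] at h2 h3
    rw [hxt] at h2 h3
    linarith
  have hzx : z = x t := Prod.ext hxt.symm hp.symm
  change _ = _
  rw [hzx]
  simp only [hH.flow_orbit hx]
  rw [hxa, hxt]

/-- At the initial point of a calibrated orbit, the momentum is a subdifferential of `u`. -/
theorem IsAdmissible.exists_quadratic_lower_bound (hH : IsAdmissible H m M) (hτ : τ < t)
    (hu : LipschitzWith k u) : ∃ C : ℝ, ∀ z ∈ calibratedSet H τ t u, ∀ ζ : Conf d,
      inner ℝ (flow H t τ z).2 (ζ - (flow H t τ z).1) - C * ‖ζ - (flow H t τ z).1‖ ^ 2 ≤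
        u ζ - u (flow H t τ z).1 := by
  obtain ⟨n, hn, -, hst⟩ := hH.exists_short_step τ t one_pos
  have hlt := node_lt_succ hτ hn 0
  have hsh : node τ t n (0 + 1) - node τ t n 0 ≤ shortTime m M := by
    rwa [node_succ_sub]
  -- The constant depends only on the first time step, hence is uniform over the calibrated set; the
  -- Lipschitz constant of the graph relies on this.
  obtain ⟨C, hC⟩ := hH.exists_genFun_semiconcave_left hlt hsh
  refine ⟨C, fun z hz ζ => ?_⟩
  have hx := hH.isOrbit_flow t z
  set x : ℝ → Phase d := fun s => flow H t s z with hxdef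
  have hz' : u (x τ).1 + action H τ t x = laxOleinik H τ t u z.1 := hz
  have hxt : x t = z := hH.flow_self t z
  set θ : ℕ → Conf d := fun j => (x (node τ t n j)).1 with hθ
  have h1 := (hH.exists_minimizing_orbit hτ hn hst hu z.1).2 (Function.update θ 0 ζ) (by
    rw [Function.update_of_ne (by omega)]
    simp only [hθ]
    rw [node_self hn, hxt])
  have h2 := brokenAction_update_first_sub (H := H) (τ := τ) (t := t) (θ := θ) hn ζ
  have h3 := hC x hx ζ
  have h4 := hH.brokenAction_orbit hτ hn hst hx (θ := θ) fun _ _ => rfl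
  rw [Function.update_self] at h1
  simp only [hθ, zero_add] at h1 h2 h3 h4
  simp only [node_zero] at h2 h3
  change inner ℝ (x τ).2 (ζ - (x τ).1) - C * ‖ζ - (x τ).1‖ ^ 2 ≤ u ζ - u (x τ).1
  linarith

end Calibrated

end LaxOleinik

/-! ### Conclusion. -/

theorem mainTheorem8 (d : ℕ) (H : ℝ × LaxOleinik.Conf d × LaxOleinik.Conf d → ℝ) (m M : ℝ)
    (hH : LaxOleinik.IsAdmissible H m M)
    (u : LaxOleinik.Conf d → ℝ) (hsc : LaxOleinik.IsSemiconcave u)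
    (hLip : ∃ k : NNReal, LipschitzWith k u) (t : ℝ) (ht : 0 < t) :
    LaxOleinik.flow H t 0 '' closure (LaxOleinik.diffGraph (LaxOleinik.laxOleinik H 0 t u)) ⊆
        LaxOleinik.diffGraph u ∧
      LaxOleinik.IsLipschitzGraph
        (LaxOleinik.flow H t 0 ''
          closure (LaxOleinik.diffGraph (LaxOleinik.laxOleinik H 0 t u))) := by
  obtain ⟨k, hu⟩ := hLip
  obtain ⟨K, hK⟩ := hsc
  obtain ⟨C, hC⟩ := hH.exists_quadratic_lower_bound ht hu
  set G := LaxOleinik.flow H t 0 ''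
    closure (LaxOleinik.diffGraph (LaxOleinik.laxOleinik H 0 t u)) with hG
  have hbound : ∀ x ∈ G, ∀ ζ, |u ζ - u x.1 - inner ℝ x.2 (ζ - x.1)| ≤
      max |C| |K| * ‖ζ - x.1‖ ^ 2 := by
    rintro _ ⟨z, hz, rfl⟩ ζ
    -- Limits of points of the graph are still calibrated, so the bounds at the initial end hold on
    -- the whole closure.
    have hz' := closure_minimal (hH.diffGraph_subset_calibratedSet ht hu)
      (hH.isClosed_calibratedSet ht hu) hz
    have h1 := hC z hz' ζ
    have h2 := LaxOleinik.quadratic_upper_bound_of_lower_bound hK (hC z hz') ζ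
    have h3 := mul_le_mul_of_nonneg_right ((le_abs_self C).trans (le_max_left |C| |K|))
      (sq_nonneg ‖ζ - (LaxOleinik.flow H t 0 z).1‖)
    have h4 := mul_le_mul_of_nonneg_right ((le_abs_self K).trans (le_max_right |C| |K|))
      (sq_nonneg ‖ζ - (LaxOleinik.flow H t 0 z).1‖)
    rw [abs_le]
    constructor <;> linarith
  have hgrad : ∀ x ∈ G, HasGradientAt u x.2 x.1 := fun x hx =>
    LaxOleinik.hasGradientAt_of_quadratic_bounds (hbound x hx)
  refine ⟨hgrad, Prod.fst '' G, gradient u, (6 * max |C| |K| + 1).toNNReal, ?_, ?_⟩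
  · refine LipschitzOnWith.of_dist_le_mul ?_
    rintro _ ⟨x, hx, rfl⟩ _ ⟨y, hy, rfl⟩
    have h0 : 0 ≤ max |C| |K| := (abs_nonneg C).trans (le_max_left _ _)
    rw [dist_eq_norm, dist_eq_norm, (hgrad x hx).gradient, (hgrad y hy).gradient,
      Real.coe_toNNReal _ (by positivity)]
    exact LaxOleinik.norm_sub_le_of_quadratic_bounds h0 (hbound x hx) (hbound y hy)
  · rw [image_image]
    ext x
    constructor
    · exact fun hx => ⟨x, hx, Prod.ext rfl (hgrad x hx).gradient⟩
    · rintro ⟨y, hy, rfl⟩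
      have : (y.1, gradient u y.1) = y := Prod.ext rfl (hgrad y hy).gradient
      simpa only [this] using hy
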